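/- **Proposition 4.1.** Let $\alpha\in\,]0,2[$ and let $g$ be a continuous probability density on $[0,\infty[$ with $\int_0^\infty x\,g(x)\,dx=1$ and $g<1/\alpha$ almost everywhere. Put $$G(x)=\int_0^x g(t)\,dt,\qquad h(x)=\frac{(1-\alpha g(x))(1-G(x))}{1-\alpha/2},\qquad H(x)=\int_0^x h(t)\,dt ,$$ $$\psi(\eta)=\frac{g(H^{-1}(\eta))}{h(H^{-1}(\eta))}\qquad(0\le\eta\le 1),$$ where $H^{-1}(\eta)=\inf\{x\ge 0: H(x)\ge\eta\}$. Let $\epsilon>0$ and let $E_n>\epsilon n(n-1)/2$ $(n\ge 2)$ be energies such that $\alpha_n:=\epsilon n(n-1)/E_n\to\alpha$. For $n\ge 2$ let $\eta_1\le\dots\le\eta_{n-1}$ be the order statistics of $n-1$ i.i.d. random variables with density $\psi$ on $[0,1]$, put $\eta_0=0$, $\eta_n=1$, $\tilde z_i=\eta_i-\eta_{i-1}$ $(1\le i\le n)$, and $$x_j=n\Bigl(1-\frac{\alpha_n}{2}\Bigr)\Bigl(\frac{\tilde z_1}{n}+\frac{\tilde z_2}{n-1}+\dots+\frac{\tilde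 z_j}{n+1-j}\Bigr)+\frac{j-1}{n-1}\,\alpha_n ,\qquad 1\le j\le n .$$ Let $F_n$ be the law of $(x_1,\dots,x_n)$, averaged over all permutations of the coordinates. A point $y$ is called *admissible* for a configuration $(x_1,\dots,x_n)$ if $|y-x_j|>\alpha_n/(n-1)$ for all $j=1,\dots,n$. Then there is a sequence $\delta_n>0$ with $\delta_n\to 0$ such that for every $x\ge 0$ the following holds: if $(x_1,\dots,x_n)$ has law $F_n$ and $x_*$ is independent of it and uniformly distributed in $[x,x+\delta_n]$, then $$\lim_{n\to\infty}\mathbb P[\,x_*\text{ is admissible}\,]=(1-\alpha g(x))\exp\left(-\frac{\alpha g(x)}{1-\alpha g(x)}\right),$$ where the right-hand side is read as $0$ at points $x$ with $\alpha g(x)=1$. -/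

import Mathlib

open MeasureTheory Set Filter Topology
open scoped ENNReal

noncomputable section

namespace KacExclusion

/-- Cumulative distribution function `x ↦ ∫₀ˣ f` of a density `f` on `[0,∞)`, for `x ≥ 0`. -/
def cdf (f : ℝ → ℝ) (x : ℝ) : ℝ := ∫ t in (0 : ℝ)..x, f t

/-- Quantile function (generalized inverse of the distribution function) of a density `f` on
`[0,∞)`. -/
def quantile (f : ℝ → ℝ) (η : ℝ) : ℝ := sInf {x : ℝ | 0 ≤ x ∧ η ≤ cdf f x}

/-- The excess energy density `h = (1 - α g) (1 - G) / (1 - α / 2)`, with `G` the distribution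
function of `g`. -/
def excessDensity (g : ℝ → ℝ) (α : ℝ) (x : ℝ) : ℝ :=
  1 / (1 - α / 2) * (1 - α * g x) * (1 - cdf g x)

/-- The density `ψ(η) = g(H⁻¹(η)) / h(H⁻¹(η))` on `[0,1]`, where `h` is the excess energy density
and `H` its distribution function. -/
def sampleDensity (g : ℝ → ℝ) (α : ℝ) (η : ℝ) : ℝ :=
  g (quantile (excessDensity g α) η) / excessDensity g α (quantile (excessDensity g α) η)

/-- The law `ψ(η) dη` on `[0,1]`. -/
def sampleLaw (g : ℝ → ℝ) (α : ℝ) : Measure ℝ :=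
  (volume.restrict (Icc (0 : ℝ) 1)).withDensity fun η => ENNReal.ofReal (sampleDensity g α η)

/-- Order statistics `η₁ ≤ ⋯ ≤ η_m` of `y`, completed by `η₀ = 0` and `η_{m+1} = 1`. -/
def orderStat {m : ℕ} (y : Fin m → ℝ) : ℕ → ℝ
  | 0 => 0
  | k + 1 => if hk : k < m then y (Tuple.sort y ⟨k, hk⟩) else 1

/-- The spacings `η_i - η_{i-1}`, `i = 1, …, n`, of the order statistics of `n - 1` points
of `[0,1]`; they form a point of the standard simplex. The index is shifted: the entry `i : Fin n`
is the spacing number `i + 1`. -/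
def spacings (n : ℕ) (y : Fin (n - 1) → ℝ) (i : Fin n) : ℝ :=
  orderStat y ((i : ℕ) + 1) - orderStat y (i : ℕ)

/-- The parametrization of the ordered configurations of the (rescaled) state space by the standard
simplex: with indices starting from `1`,
`x_j = n (1 - a / 2) (z₁ / n + z₂ / (n - 1) + ⋯ + z_j / (n + 1 - j)) + a (j - 1) / (n - 1)`. -/
def simplexMap (n : ℕ) (a : ℝ) (z : Fin n → ℝ) (j : Fin n) : ℝ :=
  (n : ℝ) * (1 - a / 2) * (∑ i ∈ Finset.Iic j, z i / ((n : ℝ) - (i : ℕ)))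
    + ((j : ℕ) : ℝ) / ((n : ℝ) - 1) * a

/-- Average of a law on `ℝⁿ` over all permutations of the coordinates. -/
def symmetrize {n : ℕ} (ν : Measure (Fin n → ℝ)) : Measure (Fin n → ℝ) :=
  (n.factorial : ℝ≥0∞)⁻¹ • ∑ σ : Equiv.Perm (Fin n), ν.map fun x => x ∘ σ

/-- The law of the rescaled `n`-particle configuration: take the order statistics of `n - 1` i.i.d.
points with density `ψ`, push the law of their spacings forward by the parametrization of the state
space with parameter `a`, and average over permutations. -/
def configLaw (g : ℝ → ℝ) (α : ℝ) (n : ℕ) (a : ℝ) : Measure (Fin n → ℝ) :=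
  symmetrize
    (((Measure.pi fun _ : Fin (n - 1) => sampleLaw g α).map (spacings n)).map (simplexMap n a))

/-- The parameter `α_n = ε n (n - 1) / E_n`. -/
def alphaParam (ε : ℝ) (E : ℕ → ℝ) (n : ℕ) : ℝ := ε * n * (n - 1) / E n

/-- `y` is an admissible position for the rescaled configuration `x` of `n` particles: it has
distance greater than `ε_n = a / (n - 1)` from every particle. -/
def Admissible (n : ℕ) (a : ℝ) (x : Fin n → ℝ) (y : ℝ) : Prop :=
  ∀ j, a / ((n : ℝ) - 1) < |y - x j|

/-- Probability that a point chosen uniformly in `[x, x + δ]`, independently of the configuration,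
is admissible. -/
def admissibleProb (g : ℝ → ℝ) (α : ℝ) (n : ℕ) (a x δ : ℝ) : ℝ :=
  ((configLaw g α n a).prod (ProbabilityTheory.cond volume (Icc x (x + δ)))).real
    {p | Admissible n a p.1 p.2}

end KacExclusion

end

noncomputable section

namespace KacExclusion

open ProbabilityTheory

/-! Let `H` be the distribution function of `h` and `F` that of the sample points. Substituting `η =
H(u)` turns `ψ(η) dη` into `g(u) du`, so `F(H(s)) = G(s)` (`sampleLaw_Iio`). The ordered
configuration is the image of the sorted sample (completed by the level 1) under the random monotone
map `profile`, which has slope `n(1 - a/2)/(n - k)` after `k` sample points and jumps by the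
exclusion radius `a/(n - 1)` at each of them. Since the empirical distribution is close to `F`, the
slope at level `t` is close to `(1 - α/2)/(1 - F(t))`. Its integral up to `H(s)` is `s - αG(s)` and
the jumps contribute `αG(s)`, so the profile sends `H(s)` approximately to `s`
(`integral_inv_sampleCdf`, `abs_profile_sub_le`).

The jumps remove the forbidden zone to the right of each particle. Up to null sets, a position
between particles is therefore admissible exactly when its preimage is followed by a sample-free
interval of length radius/slope. Hence the free length in `[x, x + δ]` is about `σ` times the length
of the levels between `H(x)` and `H(x + δ)` that start a void of length `ℓ ≈ α/((n - 1)σ)`, where `σ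
= (1 - α/2)/(1 - G(x))` (`volume_admissible_le`, `le_volume_admissible`). By independence a level
starts such a void with probability `(1 - μ[η, η + ℓ))^(n-1)`, which tends to `exp(-(g/h)(α/σ))`. As
`σh = 1 - αg`, the prefactor tends to `1 - αg(x)` and the exponent is `-αg/(1 - αg)`.

The window `δ` only has to shrink slowly compared with the fluctuations of the empirical
distribution and with `|α_n - α|`, so one sequence serves every `x` (`exists_scaling`). Two
degenerate situations remain. Where `αg(x) = 1` the prefactor alone forces the limit 0. Where `G(x)
= 1` the slope blows up, but so few particles lie near `x` or beyond that almost nothing is blocked.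
-/

/-- A probability density satisfying the constraints of the problem, extended continuously to the
whole real line. -/
structure Regular (g : ℝ → ℝ) (α : ℝ) : Prop where
  pos : 0 < α
  lt_two : α < 2
  cont : Continuous g
  nonneg : ∀ x, 0 ≤ g x
  mul_le : ∀ x, α * g x ≤ 1
  ae_lt : ∀ᵐ x ∂(volume.restrict (Ioi (0 : ℝ))), α * g x < 1
  mass : ∫ x in Ioi (0 : ℝ), g x = 1
  mean : ∫ x in Ioi (0 : ℝ), x * g x = 1

/-! ### Distribution functions of continuous densities -/

@[simp] lemma cdf_zero (f : ℝ → ℝ) : cdf f 0 = 0 := by simp [cdf]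

lemma hasDerivAt_cdf {f : ℝ → ℝ} (hf : Continuous f) (x : ℝ) :
    HasDerivAt (cdf f) (f x) x :=
  intervalIntegral.integral_hasDerivAt_right (hf.intervalIntegrable _ _)
    (hf.stronglyMeasurableAtFilter _ _) hf.continuousAt

lemma continuous_cdf {f : ℝ → ℝ} (hf : Continuous f) : Continuous (cdf f) :=
  continuous_iff_continuousAt.2 fun x => (hasDerivAt_cdf hf x).continuousAt

lemma cdf_sub {f : ℝ → ℝ} (hf : Continuous f) (u v : ℝ) :
    cdf f v - cdf f u = ∫ t in u..v, f t :=
  intervalIntegral.integral_interval_sub_left (hf.intervalIntegrable _ _)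
    (hf.intervalIntegrable _ _)

lemma cdf_mono {f : ℝ → ℝ} (hf : Continuous f) (h0 : ∀ x, 0 ≤ f x) :
    Monotone (cdf f) :=
  monotone_of_hasDerivAt_nonneg (hasDerivAt_cdf hf) h0

/-- The distribution function of the excess energy density. -/
abbrev excessCdf (g : ℝ → ℝ) (α : ℝ) : ℝ → ℝ := cdf (excessDensity g α)

lemma ae_sampleLaw_mem_Icc (g : ℝ → ℝ) (α : ℝ) :
    ∀ᵐ t ∂sampleLaw g α, t ∈ Icc (0 : ℝ) 1 :=
  (withDensity_absolutelyContinuous _ _).ae_le (ae_restrict_mem measurableSet_Icc)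

/-- The distribution function of the law of the sample points. -/
abbrev sampleCdf (g : ℝ → ℝ) (α : ℝ) (t : ℝ) : ℝ := (sampleLaw g α).real (Iio t)

/-! ### The excess distribution function and the law of the sample points -/

namespace Regular

variable {g : ℝ → ℝ} {α : ℝ}

lemma half_pos (hg : Regular g α) : 0 < 1 - α / 2 := by linarith [hg.lt_two]

lemma cont_cdf (hg : Regular g α) : Continuous (cdf g) := continuous_cdf hg.cont

lemma mono_cdf (hg : Regular g α) : Monotone (cdf g) := cdf_mono hg.cont hg.nonneg

lemma integrableOn (hg : Regular g α) : IntegrableOn g (Ioi 0) := by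
  by_contra h
  have := integral_undef h
  rw [hg.mass] at this
  exact one_ne_zero this

lemma integrableOn_mul (hg : Regular g α) : IntegrableOn (fun x => x * g x) (Ioi 0) := by
  by_contra h
  have := integral_undef h
  rw [hg.mean] at this
  exact one_ne_zero this

lemma tendsto_cdf (hg : Regular g α) : Tendsto (cdf g) atTop (𝓝 1) := by
  rw [← hg.mass]
  exact intervalIntegral_tendsto_integral_Ioi 0 hg.integrableOn tendsto_id

lemma cdf_le_one (hg : Regular g α) (x : ℝ) : cdf g x ≤ 1 :=
  hg.mono_cdf.ge_of_tendsto hg.tendsto_cdf x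

lemma cdf_nonneg (hg : Regular g α) {x : ℝ} (hx : 0 ≤ x) : 0 ≤ cdf g x := by
  simpa using hg.mono_cdf hx

lemma cont_excess (hg : Regular g α) : Continuous (excessDensity g α) := by
  have := hg.cont
  have := hg.cont_cdf
  unfold excessDensity
  fun_prop

lemma excess_nonneg (hg : Regular g α) (x : ℝ) : 0 ≤ excessDensity g α x := by
  have := hg.mul_le x
  have := hg.cdf_le_one x
  have := hg.half_pos
  unfold excessDensity
  apply mul_nonneg (mul_nonneg (by positivity) _) <;> linarith

lemma excess_pos (hg : Regular g α) {x : ℝ} (h1 : α * g x < 1) (h2 : cdf g x < 1) :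
    0 < excessDensity g α x := by
  have := hg.half_pos
  unfold excessDensity
  apply mul_pos (mul_pos (by positivity) _) <;> linarith

lemma excess_mul (hg : Regular g α) (x : ℝ) :
    (1 - α / 2) * excessDensity g α x = (1 - α * g x) * (1 - cdf g x) := by
  have := hg.half_pos.ne'
  rw [excessDensity, ← mul_assoc, ← mul_assoc, mul_one_div_cancel this, one_mul]

lemma hasDerivAt_excessCdf (hg : Regular g α) (x : ℝ) :
    HasDerivAt (excessCdf g α) (excessDensity g α x) x := hasDerivAt_cdf hg.cont_excess x

lemma cont_excessCdf (hg : Regular g α) : Continuous (excessCdf g α) :=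
  continuous_cdf hg.cont_excess

lemma mono_excessCdf (hg : Regular g α) : Monotone (excessCdf g α) :=
  cdf_mono hg.cont_excess hg.excess_nonneg

lemma excessCdf_nonneg (hg : Regular g α) {x : ℝ} (hx : 0 ≤ x) : 0 ≤ excessCdf g α x := by
  simpa using hg.mono_excessCdf hx

/-- Both sides vanish at 0 and have derivative `(1 - αg)(1 - G)`. With mass and mean equal to 1 the
right side tends to `1 - α/2`, which is why `h` has total mass 1. -/
lemma excessCdf_eq (hg : Regular g α) (x : ℝ) :
    (1 - α / 2) * excessCdf g α x =
      x * (1 - cdf g x) + (∫ t in (0 : ℝ)..x, t * g t) - α * (cdf g x - cdf g x ^ 2 / 2) := by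
  have hc : Continuous fun t : ℝ => t * g t := continuous_id.mul hg.cont
  have h1 : ∀ t, HasDerivAt (fun x => x * (1 - cdf g x) + (∫ t in (0 : ℝ)..x, t * g t)
      - α * (cdf g x - cdf g x ^ 2 / 2)) ((1 - α / 2) * excessDensity g α t) t := by
    intro t
    rw [hg.excess_mul]
    have hG := hasDerivAt_cdf hg.cont t
    have hI : HasDerivAt (fun x => ∫ t in (0 : ℝ)..x, t * g t) (t * g t) t := hasDerivAt_cdf hc t
    convert! (((hasDerivAt_id t).mul (hG.const_sub 1)).add hI).sub
      ((hG.sub ((hG.pow 2).div_const 2)).const_mul α) using 1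
    simp
    ring
  have h2 := intervalIntegral.integral_eq_sub_of_hasDerivAt (fun t _ => h1 t)
    ((continuous_const.mul hg.cont_excess).intervalIntegrable 0 x)
  rw [intervalIntegral.integral_const_mul] at h2
  simpa [excessCdf, cdf] using h2

/-- On the tail beyond `x` one has `x g(t) ≤ t g(t)`, so the product is dominated by the tail of the
convergent mean. -/
lemma tendsto_tail_mean (hg : Regular g α) :
    Tendsto (fun x => x * (1 - cdf g x)) atTop (𝓝 0) := by
  have hc : Continuous fun t : ℝ => t * g t := continuous_id.mul hg.cont
  have h1 : Tendsto (fun x => ∫ t in (0 : ℝ)..x, t * g t) atTop (𝓝 1) := by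
    rw [← hg.mean]
    exact intervalIntegral_tendsto_integral_Ioi 0 hg.integrableOn_mul tendsto_id
  have h2 : Tendsto (fun x => 1 - ∫ t in (0 : ℝ)..x, t * g t) atTop (𝓝 0) := by
    simpa using h1.const_sub 1
  refine squeeze_zero' (eventually_ge_atTop 0 |>.mono fun x hx =>
    mul_nonneg hx (by linarith [hg.cdf_le_one x])) ?_ h2
  filter_upwards [eventually_ge_atTop (0 : ℝ)] with x hx
  have h3 : Tendsto (fun y => x * (cdf g y - cdf g x)) atTop (𝓝 (x * (1 - cdf g x))) :=
    (hg.tendsto_cdf.sub_const _).const_mul _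
  have h4 := h1.sub_const (∫ t in (0 : ℝ)..x, t * g t)
  refine le_of_tendsto_of_tendsto h3 h4 ?_
  filter_upwards [eventually_ge_atTop x] with y hy
  rw [cdf_sub hg.cont, intervalIntegral.integral_interval_sub_left (hc.intervalIntegrable _ _)
    (hc.intervalIntegrable _ _), ← intervalIntegral.integral_const_mul]
  refine intervalIntegral.integral_mono_on hy ((hg.cont.const_mul x).intervalIntegrable _ _)
    (hc.intervalIntegrable _ _) fun t ht => ?_
  exact mul_le_mul_of_nonneg_right ht.1 (hg.nonneg t)

lemma tendsto_excessCdf (hg : Regular g α) : Tendsto (excessCdf g α) atTop (𝓝 1) := by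
  have h1 : Tendsto (fun x => ∫ t in (0 : ℝ)..x, t * g t) atTop (𝓝 1) := by
    rw [← hg.mean]
    exact intervalIntegral_tendsto_integral_Ioi 0 hg.integrableOn_mul tendsto_id
  have h2 := (hg.tendsto_tail_mean.add h1).sub
    ((hg.tendsto_cdf.sub ((hg.tendsto_cdf.pow 2).div_const 2)).const_mul α)
  have h3 := h2.const_mul (1 - α / 2)⁻¹
  have h0 := hg.half_pos.ne'
  refine (h3.congr fun x => ?_).trans_eq ?_
  · rw [← hg.excessCdf_eq, inv_mul_cancel_left₀ h0]
  · rw [show (0 : ℝ) + 1 - α * (1 - 1 ^ 2 / 2) = 1 - α / 2 by ring, inv_mul_cancel₀ h0]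

lemma excessCdf_le_one (hg : Regular g α) (x : ℝ) : excessCdf g α x ≤ 1 :=
  hg.mono_excessCdf.ge_of_tendsto hg.tendsto_excessCdf x

/-- The factor `1 - αg` may vanish, but only on a null set of positive reals. Every interval
starting at a point with `G < 1` therefore contains a point where `h > 0`. -/
lemma excessCdf_lt (hg : Regular g α) {u v : ℝ} (hu : 0 ≤ u) (huv : u < v) (h : cdf g u < 1) :
    excessCdf g α u < excessCdf g α v := by
  have h1 : ∀ᶠ w in 𝓝[>] u, cdf g w < 1 :=
    (hg.cont_cdf.continuousAt.eventually (gt_mem_nhds h)).filter_mono nhdsWithin_le_nhds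
  obtain ⟨w, hw, hwu⟩ := (h1.and (Ioo_mem_nhdsGT huv)).exists
  have h2 : ∃ c ∈ Ioo u w, α * g c < 1 := by
    by_contra! hcon
    have h3 := hg.ae_lt
    rw [ae_restrict_iff' measurableSet_Ioi] at h3
    have h4 : volume (Ioo u w) = 0 := by
      refine measure_mono_null (fun c hc => ?_) h3
      simp only [mem_compl_iff, mem_ofPred_eq]
      intro h5
      exact absurd (h5 (hu.trans_lt hc.1)) (not_lt.2 (hcon c hc))
    rw [Real.volume_Ioo] at h4
    have := ENNReal.ofReal_eq_zero.1 h4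
    linarith [hwu.1]
  obtain ⟨c, hc, hc'⟩ := h2
  have h5 : 0 < ∫ t in u..v, excessDensity g α t :=
    intervalIntegral.integral_pos huv hg.cont_excess.continuousOn
      (fun t _ => hg.excess_nonneg t)
      ⟨c, ⟨hc.1.le, (hc.2.trans hwu.2).le⟩,
        hg.excess_pos hc' ((hg.mono_cdf hc.2.le).trans_lt hw)⟩
  rw [← cdf_sub hg.cont_excess] at h5
  exact sub_pos.1 h5

lemma quantile_excessCdf (hg : Regular g α) {u : ℝ} (hu : 0 ≤ u) (h : ∀ v < u, cdf g v < 1) :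
    quantile (excessDensity g α) (excessCdf g α u) = u := by
  have : {x : ℝ | 0 ≤ x ∧ excessCdf g α u ≤ excessCdf g α x} = Ici u := by
    ext x
    refine ⟨fun hx => ?_, fun hx => ⟨hu.trans hx, hg.mono_excessCdf hx⟩⟩
    by_contra hxu
    exact absurd hx.2 (not_le.2 (hg.excessCdf_lt hx.1 (not_le.1 hxu) (h x (not_le.1 hxu))))
  rw [quantile, this, csInf_Ici]

lemma injOn_excessCdf (hg : Regular g α) {s : ℝ} (h : ∀ v < s, cdf g v < 1) :
    InjOn (excessCdf g α) (Ico 0 s) := by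
  intro u hu v hv huv
  by_contra hne
  rcases lt_or_gt_of_ne hne with h1 | h1
  · exact absurd huv (hg.excessCdf_lt hu.1 h1 (h _ hu.2)).ne
  · exact absurd huv (hg.excessCdf_lt hv.1 h1 (h _ hv.2)).ne'

lemma image_excessCdf (hg : Regular g α) {s : ℝ} (hs : 0 ≤ s) (h : ∀ v < s, cdf g v < 1) :
    excessCdf g α '' Ico 0 s = Ico 0 (excessCdf g α s) := by
  apply Subset.antisymm
  · rintro _ ⟨u, hu, rfl⟩
    exact ⟨hg.excessCdf_nonneg hu.1, hg.excessCdf_lt hu.1 hu.2 (h u hu.2)⟩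
  · simpa using intermediate_value_Ico hs hg.cont_excessCdf.continuousOn

lemma lintegral_excessCdf (hg : Regular g α) {s : ℝ} (hs : 0 ≤ s) (h : ∀ v < s, cdf g v < 1)
    (φ : ℝ → ℝ≥0∞) :
    ∫⁻ t in Ico 0 (excessCdf g α s), φ t =
      ∫⁻ u in Ico 0 s, ENNReal.ofReal (excessDensity g α u) * φ (excessCdf g α u) := by
  rw [← hg.image_excessCdf hs h, lintegral_image_eq_lintegral_abs_deriv_mul measurableSet_Ico
    (fun x _ => (hg.hasDerivAt_excessCdf x).hasDerivWithinAt) (hg.injOn_excessCdf h)]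
  simp_rw [abs_of_nonneg (hg.excess_nonneg _)]

lemma integral_excessCdf (hg : Regular g α) {s : ℝ} (hs : 0 ≤ s) (h : ∀ v < s, cdf g v < 1)
    (φ : ℝ → ℝ) :
    ∫ t in Ico 0 (excessCdf g α s), φ t =
      ∫ u in Ico 0 s, excessDensity g α u * φ (excessCdf g α u) := by
  rw [← hg.image_excessCdf hs h, integral_image_eq_integral_abs_deriv_smul measurableSet_Ico
    (fun x _ => (hg.hasDerivAt_excessCdf x).hasDerivWithinAt) (hg.injOn_excessCdf h)]
  simp_rw [abs_of_nonneg (hg.excess_nonneg _), smul_eq_mul]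

/-- Change of variables `η = H(u)`: the Jacobian `h(u)` cancels the denominator of `ψ(H(u)) =
g(u)/h(u)` wherever `h(u) > 0`, that is, almost everywhere on the interval. -/
lemma sampleLaw_Iio_of_lt (hg : Regular g α) {s : ℝ} (hs : 0 ≤ s) (h : ∀ v < s, cdf g v < 1) :
    sampleLaw g α (Iio (excessCdf g α s)) = ENNReal.ofReal (cdf g s) := by
  have h1 : Iio (excessCdf g α s) ∩ Icc 0 1 = Ico 0 (excessCdf g α s) := by
    ext t
    have := hg.excessCdf_le_one s
    simp only [mem_inter_iff, mem_Iio, mem_Icc, mem_Ico]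
    constructor
    · rintro ⟨h1, h2, h3⟩
      exact ⟨h2, h1⟩
    · rintro ⟨h1, h2⟩
      exact ⟨h2, h1, by linarith⟩
  rw [sampleLaw, withDensity_apply _ measurableSet_Iio, Measure.restrict_restrict measurableSet_Iio,
    h1, hg.lintegral_excessCdf hs h]
  have h2 : ∫⁻ u in Ico 0 s, ENNReal.ofReal (excessDensity g α u) *
      ENNReal.ofReal (sampleDensity g α (excessCdf g α u)) = ∫⁻ u in Ioc 0 s, ENNReal.ofReal (g u) := by
    rw [← restrict_Ioo_eq_restrict_Ico, ← restrict_Ioo_eq_restrict_Ioc]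
    refine lintegral_congr_ae ?_
    have h3 := ae_restrict_of_ae_restrict_of_subset (s := Ioo 0 s)
      (fun _ hx => hx.1) hg.ae_lt
    filter_upwards [h3, ae_restrict_mem measurableSet_Ioo] with u hu1 hu2
    have hpos := hg.excess_pos hu1 (h u hu2.2)
    rw [← ENNReal.ofReal_mul hpos.le, sampleDensity,
      hg.quantile_excessCdf hu2.1.le fun v hv => h v (hv.trans hu2.2)]
    rw [mul_div_cancel₀ _ hpos.ne']
  rw [h2, cdf, intervalIntegral.integral_of_le hs, ofReal_integral_eq_lintegral_ofReal]
  · exact (hg.cont.integrableOn_Icc (a := 0) (b := s)).mono_set Ioc_subset_Icc_self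
  · exact Eventually.of_forall hg.nonneg

lemma sampleLaw_Iio (hg : Regular g α) {s : ℝ} (hs : 0 ≤ s) :
    sampleLaw g α (Iio (excessCdf g α s)) = ENNReal.ofReal (cdf g s) := by
  by_cases h : ∀ v < s, cdf g v < 1
  · exact hg.sampleLaw_Iio_of_lt hs h
  push Not at h
  obtain ⟨v, hv, hv1⟩ := h
  -- `sInf T` is the first point where `G` reaches 1. Beyond it `h = 0`, so `H` is constant and the
  -- previous case applies at `sInf T`.
  set T := {x : ℝ | 1 ≤ cdf g x} with hT
  have hTc : IsClosed T := isClosed_le continuous_const hg.cont_cdf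
  have hT0 : ∀ x ∈ T, 0 ≤ x := by
    intro x hx
    by_contra hx0
    have h1 := hg.mono_cdf (not_le.1 hx0).le
    rw [cdf_zero] at h1
    have : 1 ≤ cdf g x := hx
    linarith
  have hTb : BddBelow T := ⟨0, hT0⟩
  have hb : sInf T ∈ T := hTc.csInf_mem ⟨v, hv1⟩ hTb
  have hbs : sInf T ≤ s := (csInf_le hTb hv1).trans hv.le
  have h1 : ∀ w < sInf T, cdf g w < 1 := by
    intro w hw
    by_contra hcon
    exact absurd (csInf_le hTb (not_lt.1 hcon)) (not_le.2 hw)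
  have h2 : ∀ w, sInf T ≤ w → cdf g w = 1 := fun w hw =>
    le_antisymm (hg.cdf_le_one w) (hb.trans (hg.mono_cdf hw))
  have h3 : excessCdf g α s = excessCdf g α (sInf T) := by
    rw [← sub_eq_zero, excessCdf, cdf_sub hg.cont_excess]
    refine intervalIntegral.integral_zero_ae (Eventually.of_forall fun w hw => ?_)
    rw [uIoc_of_le hbs] at hw
    simp [excessDensity, h2 w hw.1.le]
  rw [h3, hg.sampleLaw_Iio_of_lt (hT0 _ hb) h1, h2 _ le_rfl, h2 _ hbs]

lemma sampleLaw_univ (hg : Regular g α) : sampleLaw g α univ = 1 := by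
  have h1 : sampleLaw g α (⋃ k : ℕ, Iio (excessCdf g α k)) = 1 := by
    have hm : Monotone fun k : ℕ => Iio (excessCdf g α k) := fun i j hij =>
      Iio_subset_Iio (hg.mono_excessCdf (by exact_mod_cast hij))
    have h2 := tendsto_measure_iUnion_atTop (μ := sampleLaw g α) hm
    have h3 : Tendsto (fun k : ℕ => ENNReal.ofReal (cdf g k)) atTop (𝓝 (ENNReal.ofReal 1)) :=
      ENNReal.tendsto_ofReal (hg.tendsto_cdf.comp tendsto_natCast_atTop_atTop)
    refine tendsto_nhds_unique (h2.congr fun k => ?_) (by simpa using h3)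
    exact hg.sampleLaw_Iio (Nat.cast_nonneg k)
  have h4 : Iio (1 : ℝ) ⊆ ⋃ k : ℕ, Iio (excessCdf g α k) := by
    intro t ht
    have := (hg.tendsto_excessCdf.comp tendsto_natCast_atTop_atTop).eventually (lt_mem_nhds ht)
    obtain ⟨k, hk⟩ := this.exists
    exact mem_iUnion.2 ⟨k, hk⟩
  have h5 : sampleLaw g α (Ici 1) = 0 := by
    rw [sampleLaw]
    refine withDensity_absolutelyContinuous _ _ ?_
    rw [Measure.restrict_apply measurableSet_Ici]
    refine measure_mono_null (t := {1}) (fun t ht => le_antisymm ht.2.2 ht.1) (by simp)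
  refine le_antisymm ?_ (h1 ▸ measure_mono (subset_univ _))
  rw [← Iio_union_Ici (a := (1 : ℝ))]
  refine (measure_union_le _ _).trans ?_
  rw [h5, add_zero, ← h1]
  exact measure_mono h4

lemma isProbabilityMeasure (hg : Regular g α) : IsProbabilityMeasure (sampleLaw g α) :=
  ⟨hg.sampleLaw_univ⟩

lemma sampleCdf_excessCdf (hg : Regular g α) {s : ℝ} (hs : 0 ≤ s) :
    sampleCdf g α (excessCdf g α s) = cdf g s := by
  rw [sampleCdf, measureReal_def, hg.sampleLaw_Iio hs, ENNReal.toReal_ofReal (hg.cdf_nonneg hs)]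

lemma sampleLaw_Ico (hg : Regular g α) {u v : ℝ} (hu : 0 ≤ u) (huv : u ≤ v) :
    (sampleLaw g α).real (Ico (excessCdf g α u) (excessCdf g α v)) = cdf g v - cdf g u := by
  have := hg.isProbabilityMeasure
  have h : Ico (excessCdf g α u) (excessCdf g α v) =
      Iio (excessCdf g α v) \ Iio (excessCdf g α u) := by
    ext t; simp
  rw [h, measureReal_sdiff (Iio_subset_Iio (hg.mono_excessCdf huv)) measurableSet_Iio]
  have h1 := hg.sampleCdf_excessCdf hu
  have h2 := hg.sampleCdf_excessCdf (hu.trans huv)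
  rw [sampleCdf] at h1 h2
  rw [h1, h2]

/-- With `t = H(u)` the integrand becomes `h(u)/(1 - G(u))`, and the factor `1 - G` built into `h`
cancels, leaving `1 - αg(u)`. This is the limit of the absolutely continuous part of the profile. -/
lemma integral_inv_sampleCdf (hg : Regular g α) {s : ℝ} (hs : 0 ≤ s) (h : cdf g s < 1) :
    (1 - α / 2) * ∫ t in (0 : ℝ)..excessCdf g α s, 1 / (1 - sampleCdf g α t) =
      s - α * cdf g s := by
  have hlt : ∀ v < s, cdf g v < 1 := fun v hv => (hg.mono_cdf hv.le).trans_lt h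
  rw [intervalIntegral.integral_of_le (hg.excessCdf_nonneg hs),
    ← restrict_Ioo_eq_restrict_Ioc, restrict_Ioo_eq_restrict_Ico, hg.integral_excessCdf hs hlt,
    ← integral_const_mul]
  have h1 : ∀ u ∈ Ico 0 s, (1 - α / 2) * (excessDensity g α u *
      (1 / (1 - sampleCdf g α (excessCdf g α u)))) = 1 - α * g u := by
    intro u hu
    rw [hg.sampleCdf_excessCdf hu.1, ← mul_assoc, hg.excess_mul]
    have : 1 - cdf g u ≠ 0 := by linarith [hlt u hu.2]
    field_simp
  rw [setIntegral_congr_fun measurableSet_Ico h1, ← restrict_Ioo_eq_restrict_Ico,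
    restrict_Ioo_eq_restrict_Ioc, ← intervalIntegral.integral_of_le hs,
    intervalIntegral.integral_sub (by simp) ((hg.cont.const_mul α).intervalIntegrable _ _),
    intervalIntegral.integral_const_mul]
  simp [cdf]

end Regular

/-! ### The random profile and its affine pieces -/

/-- Number of sample points below the level `t`. -/
def count {m : ℕ} (y : Fin m → ℝ) (t : ℝ) : ℕ := (Finset.univ.filter fun i => y i < t).card

/-- Slope of the parametrization on the piece number `k`. -/
def slope (n : ℕ) (a : ℝ) (k : ℕ) : ℝ := n * (1 - a / 2) / (n - k)

/-- Left end point of the image of the piece number `j`: the position of the `j`-th particle,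
shifted to the right by the exclusion radius. -/
def base (n : ℕ) (a : ℝ) (y : Fin (n - 1) → ℝ) (j : ℕ) : ℝ :=
  (∑ i ∈ Finset.range j, slope n a i * (orderStat y (i + 1) - orderStat y i)) +
    j * (a / ((n : ℝ) - 1))

/-- The random profile `t ↦ ∫₀ᵗ slope + ε · count`, which maps the sample points to the particles. -/
def profile (n : ℕ) (a : ℝ) (y : Fin (n - 1) → ℝ) (t : ℝ) : ℝ :=
  (∫ u in (0 : ℝ)..t, slope n a (count y u)) + a / ((n : ℝ) - 1) * count y t

section Config

lemma count_mono {m : ℕ} (y : Fin m → ℝ) : Monotone (count y) := fun s t hst =>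
  Finset.card_le_card fun i hi => by
    simp only [Finset.mem_filter, Finset.mem_univ, true_and] at hi ⊢
    exact hi.trans_le hst

lemma count_le {m : ℕ} (y : Fin m → ℝ) (t : ℝ) : count y t ≤ m :=
  (Finset.card_filter_le _ _).trans_eq (by simp)

lemma orderStat_succ {m : ℕ} (y : Fin m → ℝ) (i : Fin m) :
    orderStat y (i + 1) = y (Tuple.sort y i) := by
  simp [orderStat]

lemma orderStat_succ_of_le {m : ℕ} (y : Fin m → ℝ) {k : ℕ} (hk : m ≤ k) :
    orderStat y (k + 1) = 1 := by
  simp [orderStat, not_lt.2 hk]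

lemma orderStat_mem {m : ℕ} {y : Fin m → ℝ} (hy : ∀ i, y i ∈ Icc (0 : ℝ) 1) (k : ℕ) :
    orderStat y k ∈ Icc (0 : ℝ) 1 := by
  cases k with
  | zero => simp [orderStat]
  | succ k =>
    by_cases hk : k < m
    · rw [orderStat_succ y ⟨k, hk⟩]; exact hy _
    · rw [orderStat_succ_of_le y (not_lt.1 hk)]; simp

lemma orderStat_mono {m : ℕ} {y : Fin m → ℝ} (hy : ∀ i, y i ∈ Icc (0 : ℝ) 1) :
    Monotone (orderStat y) := by
  refine monotone_nat_of_le_succ fun k => ?_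
  cases k with
  | zero => exact (orderStat_mem hy _).1
  | succ k =>
    by_cases hk : k + 1 < m
    · rw [orderStat_succ y ⟨k, by omega⟩, orderStat_succ y ⟨k + 1, hk⟩]
      exact Tuple.monotone_sort y (by simp)
    · rw [orderStat_succ_of_le y (k := k + 1) (not_lt.1 hk)]
      exact (orderStat_mem hy _).2

/-- The strict inequality in `count` makes the pieces half-open on the left. A sample point belongs
to the piece that it ends, and the profile jumps only after it. -/
lemma count_eq {m : ℕ} {y : Fin m → ℝ} (hy : ∀ i, y i ∈ Icc (0 : ℝ) 1) {j : ℕ} (hj : j ≤ m)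
    {t : ℝ} (h1 : orderStat y j < t) (h2 : t ≤ orderStat y (j + 1)) : count y t = j := by
  have h3 : (Finset.univ.filter fun i => y i < t) =
      (Finset.univ.filter fun i : Fin m => (i : ℕ) < j).map (Tuple.sort y).toEmbedding := by
    ext i
    obtain ⟨i, rfl⟩ := (Tuple.sort y).surjective i
    simp only [Finset.mem_filter, Finset.mem_univ, true_and, Finset.mem_map_equiv,
      Equiv.symm_apply_apply, ← orderStat_succ]
    constructor
    · intro h
      by_contra hcon
      have := orderStat_mono hy (show j + 1 ≤ i + 1 by omega)
      linarith
    · intro h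
      exact (orderStat_mono hy (show (i : ℕ) + 1 ≤ j by omega)).trans_lt h1
  rw [count, h3, Finset.card_map, Fin.card_filter_val_lt]
  omega

lemma exists_piece {m : ℕ} {y : Fin m → ℝ} {t : ℝ} (h0 : 0 < t) (h1 : t ≤ 1) :
    ∃ j ≤ m, orderStat y j < t ∧ t ≤ orderStat y (j + 1) := by
  classical
  have hex : ∃ k, t ≤ orderStat y (k + 1) := ⟨m, by rw [orderStat_succ_of_le y le_rfl]; exact h1⟩
  refine ⟨Nat.find hex, Nat.find_min' hex (by rw [orderStat_succ_of_le y le_rfl]; exact h1), ?_,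
    Nat.find_spec hex⟩
  rcases h : Nat.find hex with _ | k
  · simpa [orderStat] using h0
  · exact not_le.1 (Nat.find_min hex (m := k) (by omega))

variable {n : ℕ} {a : ℝ}

lemma slope_pos (ha : a < 2) {k : ℕ} (hk : k < n) : 0 < slope n a k := by
  have h1 : (k : ℝ) < n := by exact_mod_cast hk
  have h2 : (0 : ℝ) ≤ k := by positivity
  unfold slope
  apply div_pos (mul_pos _ _) <;> linarith

lemma slope_mono (ha : a < 2) {k l : ℕ} (hkl : k ≤ l) (hl : l < n) :
    slope n a k ≤ slope n a l := by
  have h1 : (l : ℝ) < n := by exact_mod_cast hl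
  have h2 : (k : ℝ) ≤ l := by exact_mod_cast hkl
  have h3 : (0 : ℝ) ≤ k := by positivity
  unfold slope
  apply div_le_div_of_nonneg_left (mul_nonneg _ _) <;> linarith

lemma count_lt (hn : 2 ≤ n) (y : Fin (n - 1) → ℝ) (t : ℝ) : count y t < n := by
  have := count_le y t
  omega

lemma slope_count_mono (hn : 2 ≤ n) (ha : a < 2) (y : Fin (n - 1) → ℝ) :
    Monotone fun t => slope n a (count y t) := fun _ _ hst =>
  slope_mono ha (count_mono y hst) (count_lt hn y _)

lemma slope_count_intervalIntegrable (hn : 2 ≤ n) (ha : a < 2) (y : Fin (n - 1) → ℝ) (s t : ℝ) :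
    IntervalIntegrable (fun t => slope n a (count y t)) volume s t :=
  (slope_count_mono hn ha y).intervalIntegrable

lemma radius_pos (hn : 2 ≤ n) (ha : 0 < a) : 0 < a / ((n : ℝ) - 1) := by
  have : (2 : ℝ) ≤ n := by exact_mod_cast hn
  apply div_pos ha; linarith

lemma profile_mono (hn : 2 ≤ n) (ha0 : 0 < a) (ha : a < 2) (y : Fin (n - 1) → ℝ) :
    Monotone (profile n a y) := by
  intro s t hst
  have h1 : 0 ≤ ∫ u in s..t, slope n a (count y u) :=
    intervalIntegral.integral_nonneg hst fun u _ => (slope_pos ha (count_lt hn y u)).le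
  rw [← intervalIntegral.integral_interval_sub_left (slope_count_intervalIntegrable hn ha y 0 t)
    (slope_count_intervalIntegrable hn ha y 0 s)] at h1
  have h2 : (count y s : ℝ) ≤ count y t := by exact_mod_cast count_mono y hst
  have h3 := mul_le_mul_of_nonneg_left h2 (radius_pos hn ha0).le
  unfold profile
  linarith

lemma base_succ (y : Fin (n - 1) → ℝ) (j : ℕ) :
    base n a y (j + 1) =
      base n a y j + slope n a j * (orderStat y (j + 1) - orderStat y j) + a / ((n : ℝ) - 1) := by
  simp only [base, Finset.sum_range_succ]
  push_cast
  ring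

lemma simplexMap_spacings (y : Fin (n - 1) → ℝ) (j : Fin n) :
    simplexMap n a (spacings n y) j =
      base n a y j + slope n a j * (orderStat y (j + 1) - orderStat y j) := by
  have h1 : ∑ i ∈ Finset.Iic j, spacings n y i / ((n : ℝ) - (i : ℕ)) =
      ∑ i ∈ Finset.range (j + 1), (orderStat y (i + 1) - orderStat y i) / ((n : ℝ) - i) := by
    rw [show Finset.range ((j : ℕ) + 1) = Finset.Iic (j : ℕ) by ext; simp,
      ← Fin.map_valEmbedding_Iic, Finset.sum_map]
    rfl
  have h2 : ∀ i, slope n a i * (orderStat y (i + 1) - orderStat y i) =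
      n * (1 - a / 2) * ((orderStat y (i + 1) - orderStat y i) / ((n : ℝ) - i)) := by
    intro i
    rw [slope]; ring
  rw [simplexMap, h1, Finset.mul_sum, Finset.sum_range_succ, base]
  simp_rw [h2]
  ring

lemma simplexMap_eq_base (y : Fin (n - 1) → ℝ) (j : Fin n) :
    simplexMap n a (spacings n y) j = base n a y (j + 1) - a / ((n : ℝ) - 1) := by
  rw [simplexMap_spacings, base_succ]; ring

lemma integral_slope_piece (hn : 2 ≤ n) {y : Fin (n - 1) → ℝ} (hy : ∀ i, y i ∈ Icc (0 : ℝ) 1)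
    {j : ℕ} (hj : j < n) {t : ℝ} (h1 : orderStat y j ≤ t) (h2 : t ≤ orderStat y (j + 1)) :
    ∫ u in orderStat y j..t, slope n a (count y u) = slope n a j * (t - orderStat y j) := by
  have : ∫ u in orderStat y j..t, slope n a (count y u) =
      ∫ _ in orderStat y j..t, slope n a j := by
    refine intervalIntegral.integral_congr_ae (Eventually.of_forall fun u hu => ?_)
    rw [uIoc_of_le h1] at hu
    rw [count_eq hy (by omega) hu.1 (hu.2.trans h2)]
  rw [this, intervalIntegral.integral_const, smul_eq_mul, mul_comm]

/-- On each piece the count, hence the slope, is frozen. At the right end of the piece the value is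
the position of a particle; the following jump leads to the left end `base` of the next gap. -/
lemma profile_eq (hn : 2 ≤ n) (ha : a < 2) {y : Fin (n - 1) → ℝ}
    (hy : ∀ i, y i ∈ Icc (0 : ℝ) 1) {j : ℕ} (hj : j < n) {t : ℝ} (h1 : orderStat y j < t)
    (h2 : t ≤ orderStat y (j + 1)) :
    profile n a y t = base n a y j + slope n a j * (t - orderStat y j) := by
  have hint := slope_count_intervalIntegrable hn ha y
  have h3 : ∫ u in (0 : ℝ)..orderStat y j, slope n a (count y u) =
      ∑ i ∈ Finset.range j, slope n a i * (orderStat y (i + 1) - orderStat y i) := by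
    have := intervalIntegral.sum_integral_adjacent_intervals (n := j) (a := orderStat y)
      (fun k _ => hint (orderStat y k) (orderStat y (k + 1)))
    rw [show orderStat y 0 = 0 from rfl] at this
    rw [← this]
    refine Finset.sum_congr rfl fun k hk => integral_slope_piece hn hy
      ((Finset.mem_range.1 hk).trans hj) (orderStat_mono hy (Nat.le_succ k)) le_rfl
  rw [profile, count_eq hy (by omega) h1 h2, base,
    ← intervalIntegral.integral_add_adjacent_intervals (hint 0 (orderStat y j)) (hint _ t), h3,
    integral_slope_piece hn hy hj h1.le h2]
  ring

lemma base_mono (ha0 : 0 < a) (ha : a < 2) (hn : 2 ≤ n) {y : Fin (n - 1) → ℝ}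
    (hy : ∀ i, y i ∈ Icc (0 : ℝ) 1) {i j : ℕ} (hij : i ≤ j) (hj : j ≤ n) :
    base n a y i ≤ base n a y j := by
  induction j, hij using Nat.le_induction with
  | base => exact le_rfl
  | succ k hk ih =>
    rw [base_succ]
    have := mul_nonneg (slope_pos ha (show k < n by omega)).le
      (sub_nonneg.2 (orderStat_mono hy (Nat.le_succ k)))
    have := radius_pos hn ha0
    have := ih (by omega)
    simp only [Nat.succ_eq_add_one] at *
    linarith

lemma profile_one_le (hn : 2 ≤ n) (ha0 : 0 < a) (ha : a < 2) {y : Fin (n - 1) → ℝ}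
    (hy : ∀ i, y i ∈ Icc (0 : ℝ) 1) {t : ℝ} (ht0 : 0 ≤ t) (ht : t ≤ 1) :
    profile n a y t ≤ base n a y n - a / ((n : ℝ) - 1) := by
  rcases ht0.eq_or_lt with rfl | h0
  · have h1 : count y 0 = 0 := by
      rw [count, Finset.card_eq_zero, Finset.filter_eq_empty_iff]
      exact fun i _ => not_lt.2 (hy i).1
    have h2 := base_mono ha0 ha hn hy (show 1 ≤ n by omega) le_rfl
    rw [← zero_add 1, base_succ] at h2
    have := mul_nonneg (slope_pos ha (show 0 < n by omega)).le
      (sub_nonneg.2 (orderStat_mono hy (Nat.le_succ 0)))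
    simp only [base, Finset.range_zero, Finset.sum_empty, Nat.cast_zero, zero_mul, zero_add,
      Nat.succ_eq_add_one] at *
    simp only [profile, h1, intervalIntegral.integral_same, Nat.cast_zero, mul_zero, zero_add]
    linarith
  · obtain ⟨j, hj, h1, h2⟩ := exists_piece (y := y) h0 ht
    rw [profile_eq hn ha hy (by omega) h1 h2]
    have h3 := base_mono ha0 ha hn hy (show j + 1 ≤ n by omega) le_rfl
    rw [base_succ] at h3
    have := mul_le_mul_of_nonneg_left (sub_le_sub_right h2 (orderStat y j))
      (slope_pos ha (show j < n by omega)).le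
    linarith

end Config

/-! ### Admissible length compared with the length of the void set -/

/-- Levels `η` in `(s, t)` that are followed by an interval of length `ℓ` free of sample points. -/
def voidSet {m : ℕ} (y : Fin m → ℝ) (s t ℓ : ℝ) : Set ℝ :=
  {η | η ∈ Ioo s t ∧ ∀ i, y i ∉ Ico η (η + ℓ)}

lemma measurableSet_voidSet {m : ℕ} (s t ℓ : ℝ) :
    MeasurableSet {p : (Fin m → ℝ) × ℝ | p.2 ∈ voidSet p.1 s t ℓ} := by
  have : {p : (Fin m → ℝ) × ℝ | p.2 ∈ voidSet p.1 s t ℓ} =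
      (Prod.snd ⁻¹' Ioo s t) ∩ ⋂ i, ({p : (Fin m → ℝ) × ℝ | p.2 ≤ p.1 i} ∩
        {p : (Fin m → ℝ) × ℝ | p.1 i < p.2 + ℓ})ᶜ := by
    ext p
    simp [voidSet]
  rw [this]
  refine (measurable_snd measurableSet_Ioo).inter (MeasurableSet.iInter fun i => ?_)
  exact ((measurableSet_le (by fun_prop) (by fun_prop)).inter
    (measurableSet_lt (by fun_prop) (by fun_prop))).compl

lemma measurableSet_voidSet_apply {m : ℕ} (y : Fin m → ℝ) (s t ℓ : ℝ) :
    MeasurableSet (voidSet y s t ℓ) :=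
  measurable_prodMk_left (measurableSet_voidSet s t ℓ)

lemma volume_preimage_affine {c : ℝ} (hc : 0 < c) (b o : ℝ) (S : Set ℝ) :
    volume ((fun t => o + (t - b) / c) ⁻¹' S) = ENNReal.ofReal c * volume S := by
  have : (fun t => o + (t - b) / c) ⁻¹' S =
      (fun t => t + (-b)) ⁻¹' ((fun t => t * c⁻¹) ⁻¹' ((fun t => o + t) ⁻¹' S)) := by
    ext t
    simp [div_eq_mul_inv, sub_eq_add_neg]
  rw [this, measure_preimage_add_right, Real.volume_preimage_mul_right (inv_ne_zero hc.ne'),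
    measure_preimage_add, inv_inv, abs_of_pos hc]

variable {n : ℕ} {a : ℝ} {y : Fin (n - 1) → ℝ}

lemma sum_volume_pieces (hy : ∀ i, y i ∈ Icc (0 : ℝ) 1) (S : Set ℝ) (hS : MeasurableSet S) :
    ∑ j : Fin n, volume (S ∩ Ioc (orderStat y j) (orderStat y (j + 1))) =
      volume (⋃ j : Fin n, S ∩ Ioc (orderStat y j) (orderStat y (j + 1))) := by
  rw [measure_iUnion, tsum_fintype]
  · intro i j hij
    have h := (orderStat_mono hy).pairwise_disjoint_on_Ioc_succ
    refine (h (fun h' => hij (Fin.ext h'))).mono ?_ ?_ <;>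
    · simp only [Nat.succ_eq_succ]
      exact inter_subset_right
  · exact fun j => hS.inter measurableSet_Ioc

/-- The change of variables sending the image of the piece number `j` back to the piece. -/
def pieceInv (n : ℕ) (a : ℝ) (y : Fin (n - 1) → ℝ) (j : ℕ) (t : ℝ) : ℝ :=
  orderStat y j + (t - base n a y j) / slope n a j

lemma volume_preimage_pieceInv (ha : a < 2) {j : ℕ} (hj : j < n) (S : Set ℝ) :
    volume (pieceInv n a y j ⁻¹' S) = ENNReal.ofReal (slope n a j) * volume S :=
  volume_preimage_affine (slope_pos ha hj) _ _ _

lemma eq_of_pieceInv (ha : a < 2) {j : ℕ} (hj : j < n) (t : ℝ) :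
    t = base n a y j + slope n a j * (pieceInv n a y j t - orderStat y j) := by
  have := (slope_pos ha hj).ne'
  rw [pieceInv, add_sub_cancel_left, mul_div_cancel₀ _ this]
  ring

/-- Take the first particle to the right of `t`. Distance from its left neighbour puts `t` beyond
`base`, and distance from that particle itself leaves room radius/slope after the preimage of `t`.
-/
lemma exists_piece_of_admissible (hn : 2 ≤ n) (ha : a < 2) {t : ℝ}
    (ht : Admissible n a (simplexMap n a (spacings n y)) t) (h0 : 0 < t)
    (h1 : t < base n a y n - a / ((n : ℝ) - 1)) :
    ∃ j : Fin n, orderStat y j < pieceInv n a y j t ∧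
      pieceInv n a y j t + a / ((n : ℝ) - 1) / slope n a j < orderStat y (j + 1) := by
  classical
  have hex : ∃ j, t < base n a y (j + 1) - a / ((n : ℝ) - 1) :=
    ⟨n - 1, by rwa [Nat.sub_add_cancel (by omega)]⟩
  have hlt : Nat.find hex < n := by
    have := Nat.find_min' hex (m := n - 1) (by rwa [Nat.sub_add_cancel (by omega)])
    omega
  have h2 := Nat.find_spec hex
  refine ⟨⟨Nat.find hex, hlt⟩, ?_⟩
  have h3 : base n a y (Nat.find hex) < t := by
    rcases h : Nat.find hex with _ | k
    · simpa [base] using h0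
    · have h4 := not_lt.1 (Nat.find_min hex (m := k) (by omega))
      have h5 := ht ⟨k, by omega⟩
      rw [simplexMap_eq_base, abs_of_nonneg (by simpa using h4)] at h5
      simp only at h5
      linarith
  have h4 := ht ⟨Nat.find hex, hlt⟩
  rw [simplexMap_eq_base, abs_sub_comm, abs_of_pos (sub_pos.2 h2)] at h4
  have hs := slope_pos ha hlt
  simp only at h4 ⊢
  rw [base_succ] at h4
  rw [pieceInv]
  refine ⟨lt_add_of_pos_right _ (div_pos (by linarith) hs), ?_⟩
  rw [add_assoc, ← add_div, ← lt_sub_iff_add_lt', div_lt_iff₀ hs]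
  linarith

/-- Slopes increase with the level, so on the window they are all at most `σ`. Pulling back an
admissible point thus leaves a void at least as long as `ℓ`, and pushing the void set forward
stretches lengths by at most `σ`. -/
lemma volume_admissible_le (hn : 2 ≤ n) (ha0 : 0 < a) (ha : a < 2)
    (hy : ∀ i, y i ∈ Icc (0 : ℝ) 1) {x δ s t σ ℓ : ℝ} (hx : 0 ≤ x) (ht0 : 0 ≤ t) (ht1 : t ≤ 1)
    (h1 : profile n a y s ≤ x) (h2 : x + δ ≤ profile n a y t)
    (hσ : slope n a (count y t) ≤ σ) (hℓ : ℓ * σ ≤ a / ((n : ℝ) - 1)) :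
    volume ({u | Admissible n a (simplexMap n a (spacings n y)) u} ∩ Icc x (x + δ)) ≤
      ENNReal.ofReal σ * volume (voidSet y s t ℓ) := by
  set A := {u | Admissible n a (simplexMap n a (spacings n y)) u}
  set V := voidSet y s t ℓ
  set P := fun j : Fin n => Ioc (orderStat y j) (orderStat y (j + 1))
  have hσ0 : 0 < σ := (slope_pos ha (count_lt hn y t)).trans_le hσ
  -- Discarding the two end points gives the strict inequalities that place preimages inside the
  -- open interval `(s, t)`.
  have hae : volume (A ∩ Icc x (x + δ)) = volume (A ∩ Ioo x (x + δ)) :=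
    measure_congr ((ae_eq_refl A).inter Ioo_ae_eq_Icc.symm)
  have hsub : A ∩ Ioo x (x + δ) ⊆ ⋃ j : Fin n, pieceInv n a y j ⁻¹' (V ∩ P j) := by
    rintro u ⟨hu, hux, huδ⟩
    have hmax := profile_one_le hn ha0 ha hy ht0 ht1
    obtain ⟨j, hj1, hj2⟩ := exists_piece_of_admissible hn ha hu (hx.trans_lt hux) (by linarith)
    have hpos : 0 < a / ((n : ℝ) - 1) / slope n a j :=
      div_pos (radius_pos hn ha0) (slope_pos ha j.2)
    have hj3 : pieceInv n a y j u ≤ orderStat y (j + 1) := by linarith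
    have hprof : profile n a y (pieceInv n a y j u) = u := by
      rw [profile_eq hn ha hy j.2 hj1 hj3, ← eq_of_pieceInv ha j.2]
    have hs : s < pieceInv n a y j u := by
      by_contra hcon
      have := profile_mono hn ha0 ha y (not_lt.1 hcon)
      linarith
    have ht : pieceInv n a y j u < t := by
      by_contra hcon
      have := profile_mono hn ha0 ha y (not_lt.1 hcon)
      linarith
    have hcount : count y (pieceInv n a y j u) = j := count_eq hy (by omega) hj1 hj3
    have hslope : slope n a j ≤ σ := by
      rw [← hcount]
      exact (slope_count_mono hn ha y ht.le).trans hσ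
    refine mem_iUnion.2 ⟨j, ⟨⟨hs, ht⟩, fun i hi => ?_⟩, hj1, hj3⟩
    have h4 : orderStat y (j + 1) ≤ y i := by
      obtain ⟨i, rfl⟩ := (Tuple.sort y).surjective i
      rw [← orderStat_succ y i]
      refine orderStat_mono hy ?_
      by_contra hcon
      have h5 := orderStat_mono hy (show (i : ℕ) + 1 ≤ j by omega)
      rw [orderStat_succ] at h5
      linarith [hi.1]
    have h6 : ℓ ≤ a / ((n : ℝ) - 1) / slope n a j := by
      rw [← le_div_iff₀ hσ0] at hℓ
      exact hℓ.trans (div_le_div_of_nonneg_left (radius_pos hn ha0).le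
        (slope_pos ha j.2) hslope)
    linarith [hi.2]
  have hVm := measurableSet_voidSet_apply y s t ℓ
  calc volume (A ∩ Icc x (x + δ)) ≤ ∑ j : Fin n, volume (pieceInv n a y j ⁻¹' (V ∩ P j)) := by
        rw [hae]
        exact (measure_mono hsub).trans (measure_iUnion_fintype_le _ _)
    _ ≤ ∑ j : Fin n, ENNReal.ofReal σ * volume (V ∩ P j) := by
        refine Finset.sum_le_sum fun j _ => ?_
        rw [volume_preimage_pieceInv ha j.2]
        rcases (V ∩ P j).eq_empty_or_nonempty with he | ⟨η, hη, hη'⟩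
        · simp [he]
        · have hcount : count y η = j := count_eq hy (by omega) hη'.1 hη'.2
          gcongr
          rw [← hcount]
          exact (slope_count_mono hn ha y hη.1.2.le).trans hσ
    _ ≤ ENNReal.ofReal σ * volume V := by
        rw [← Finset.mul_sum, sum_volume_pieces hy V hVm]
        gcongr
        exact iUnion_subset fun j => inter_subset_left

/-- Converse inclusion: now `σ` bounds the slopes from below, so a void of length `ℓ` is stretched
to more than one radius and its starting level is mapped to an admissible position. -/
lemma le_volume_admissible (hn : 2 ≤ n) (ha0 : 0 < a) (ha : a < 2)
    (hy : ∀ i, y i ∈ Icc (0 : ℝ) 1) {x δ s t σ ℓ : ℝ} (hs0 : 0 ≤ s)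
    (h1 : x ≤ profile n a y s) (h2 : profile n a y t ≤ x + δ)
    (hσ0 : 0 < σ) (hσ : σ ≤ slope n a (count y s)) (hℓ : a / ((n : ℝ) - 1) < ℓ * σ)
    (htℓ : t + ℓ ≤ 1) :
    ENNReal.ofReal σ * volume (voidSet y s t ℓ) ≤
      volume ({u | Admissible n a (simplexMap n a (spacings n y)) u} ∩ Icc x (x + δ)) := by
  set A := {u | Admissible n a (simplexMap n a (spacings n y)) u}
  set V := voidSet y s t ℓ
  set P := fun j : Fin n => Ioc (orderStat y j) (orderStat y (j + 1))
  have hr := radius_pos hn ha0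
  have hℓ0 : 0 < ℓ := pos_of_mul_pos_left (hr.trans hℓ) hσ0.le
  have hkey : ∀ j : Fin n, ∀ u ∈ pieceInv n a y j ⁻¹' (V ∩ P j),
      base n a y j < u ∧ u < base n a y (j + 1) - 2 * (a / ((n : ℝ) - 1)) ∧
        u ∈ Icc x (x + δ) := by
    rintro j u ⟨hV, hP⟩
    have hs := slope_pos ha j.2
    have hcount : count y (pieceInv n a y j u) = j := count_eq hy (by omega) hP.1 hP.2
    have hprof : profile n a y (pieceInv n a y j u) = u := by
      rw [profile_eq hn ha hy j.2 hP.1 hP.2, ← eq_of_pieceInv ha j.2]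
    have hslope : σ ≤ slope n a j := by
      rw [← hcount]
      exact hσ.trans (slope_count_mono hn ha y hV.1.1.le)
    have hlo := profile_mono hn ha0 ha y hV.1.1.le
    have hhi := profile_mono hn ha0 ha y hV.1.2.le
    rw [hprof] at hlo hhi
    have hnext : pieceInv n a y j u + ℓ ≤ orderStat y (j + 1) := by
      -- The last piece ends at 1, which is not a sample point; there the room comes from `t + ℓ ≤
      -- 1`.
      by_cases hj : (j : ℕ) < n - 1
      · have h4 := orderStat_succ y ⟨j, hj⟩
        have h5 := hV.2 (Tuple.sort y ⟨j, hj⟩)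
        simp only at h4
        rw [← h4] at h5
        by_contra hcon
        exact h5 ⟨hP.2, not_le.1 hcon⟩
      · rw [orderStat_succ_of_le y (not_lt.1 hj)]
        linarith [hV.1.2]
    have hu := eq_of_pieceInv (y := y) ha j.2 u
    have h6 := mul_pos hs (sub_pos.2 hP.1)
    have h7 := mul_le_mul_of_nonneg_left hnext hs.le
    have h8 := mul_le_mul_of_nonneg_right hslope hℓ0.le
    refine ⟨by linarith, ?_, by linarith, by linarith⟩
    rw [base_succ]
    linarith
  have hadm : ∀ j : Fin n, pieceInv n a y j ⁻¹' (V ∩ P j) ⊆ A ∩ Icc x (x + δ) := by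
    intro j u hu
    obtain ⟨hu1, hu2, hu3⟩ := hkey j u hu
    refine ⟨fun i => ?_, hu3⟩
    rw [simplexMap_eq_base]
    rcases lt_or_ge (i : ℕ) j with hij | hij
    · have h4 := base_mono ha0 ha hn hy (show (i : ℕ) + 1 ≤ j by omega) j.2.le
      rw [lt_abs]
      left
      linarith
    · have h4 := base_mono ha0 ha hn hy (show (j : ℕ) + 1 ≤ i + 1 by omega) (by omega)
      rw [lt_abs]
      right
      linarith
  have hVm := measurableSet_voidSet_apply y s t ℓ
  have hunion : V ⊆ ⋃ j : Fin n, V ∩ P j := by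
    intro η hη
    have h4 : η ≤ 1 := by linarith [hη.1.2]
    obtain ⟨j, hj, hj1, hj2⟩ := exists_piece (y := y) (hs0.trans_lt hη.1.1) h4
    exact mem_iUnion.2 ⟨⟨j, by omega⟩, hη, hj1, hj2⟩
  have hmeas : ∀ j : Fin n, Measurable (pieceInv n a y j) := by
    intro j
    unfold pieceInv
    fun_prop
  calc ENNReal.ofReal σ * volume V ≤ ∑ j : Fin n, ENNReal.ofReal σ * volume (V ∩ P j) := by
        rw [← Finset.mul_sum, sum_volume_pieces hy V hVm]
        gcongr
    _ ≤ ∑ j : Fin n, volume (pieceInv n a y j ⁻¹' (V ∩ P j)) := by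
        refine Finset.sum_le_sum fun j _ => ?_
        rw [volume_preimage_pieceInv ha j.2]
        rcases (V ∩ P j).eq_empty_or_nonempty with he | ⟨η, hη, hη'⟩
        · simp [he]
        · have hcount : count y η = j := count_eq hy (by omega) hη'.1 hη'.2
          gcongr
          rw [← hcount]
          exact hσ.trans (slope_count_mono hn ha y hη.1.1.le)
    _ = volume (⋃ j : Fin n, pieceInv n a y j ⁻¹' (V ∩ P j)) := by
        -- The affine inverses are defined on the whole line, yet these preimages are disjoint since
        -- each lies in its own gap between particles.
        rw [measure_iUnion, tsum_fintype]
        · intro i j hij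
          refine Set.disjoint_left.2 fun u hi hj => ?_
          obtain ⟨hi1, hi2, -⟩ := hkey i u hi
          obtain ⟨hj1, hj2, -⟩ := hkey j u hj
          rcases lt_or_gt_of_ne (fun h => hij (Fin.ext h) : (i : ℕ) ≠ j) with h | h
          · have := base_mono ha0 ha hn hy (show (i : ℕ) + 1 ≤ j by omega) j.2.le
            linarith
          · have := base_mono ha0 ha hn hy (show (j : ℕ) + 1 ≤ i by omega) i.2.le
            linarith
        · exact fun j => hmeas j (hVm.inter measurableSet_Ioc)
    _ ≤ volume (A ∩ Icc x (x + δ)) := measure_mono (iUnion_subset hadm)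

/-- Particles numbered below `count y s` sit at least one radius to the left of `x`, so they block
nothing. Each of the others blocks at most two radii. -/
lemma volume_not_admissible_le (hn : 2 ≤ n) (ha0 : 0 < a) (ha : a < 2)
    (hy : ∀ i, y i ∈ Icc (0 : ℝ) 1) {x δ s : ℝ} (hs : s ≤ 1)
    (h1 : profile n a y s ≤ x) :
    volume (Icc x (x + δ) \ {u | Admissible n a (simplexMap n a (spacings n y)) u}) ≤
      ENNReal.ofReal ((n - count y s) * (2 * (a / ((n : ℝ) - 1)))) := by
  set ε := a / ((n : ℝ) - 1) with hε
  have hr : 0 < ε := radius_pos hn ha0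
  set T := Finset.univ.filter fun j : Fin n => count y s ≤ j with hT
  have hsub : Icc x (x + δ) \ {u | Admissible n a (simplexMap n a (spacings n y)) u} ⊆
      ⋃ j ∈ T, Metric.closedBall (simplexMap n a (spacings n y) j) ε := by
    rintro u ⟨hu, hna⟩
    simp only [Admissible, mem_ofPred_eq, not_forall, not_lt] at hna
    obtain ⟨j, hj⟩ := hna
    have hjT : count y s ≤ j := by
      by_contra hcon
      have hs0 : 0 < s := by
        by_contra hs0
        have : count y s = 0 := by
          rw [count, Finset.card_eq_zero, Finset.filter_eq_empty_iff]
          exact fun i _ => not_lt.2 ((not_lt.1 hs0).trans (hy i).1)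
        omega
      obtain ⟨k, hk, hk1, hk2⟩ := exists_piece (y := y) hs0 hs
      rw [count_eq hy hk hk1 hk2] at hcon
      rw [profile_eq hn ha hy (by omega) hk1 hk2] at h1
      have h2 := base_mono ha0 ha hn hy (show (j : ℕ) + 1 ≤ k by omega) (by omega)
      have h3 := mul_pos (slope_pos (n := n) ha (show k < n by omega)) (sub_pos.2 hk1)
      rw [simplexMap_eq_base] at hj
      have h4 := le_trans (le_abs_self _) hj
      linarith [hu.1]
    exact mem_biUnion (show j ∈ T by simpa [hT] using hjT) (by simpa [Real.dist_eq] using hj)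
  have hcard : (T.card : ℝ) = n - count y s := by
    have h2 : T.card = n - count y s := by
      have h3 := Finset.card_filter_add_card_filter_not (s := Finset.univ)
        (fun j : Fin n => (j : ℕ) < count y s)
      rw [Fin.card_filter_val_lt, Finset.card_univ, Fintype.card_fin] at h3
      simp only [not_lt] at h3
      have := count_lt hn y s
      rw [hT]
      omega
    rw [h2, Nat.cast_sub (count_lt hn y s).le]
  calc _ ≤ ∑ j ∈ T, volume (Metric.closedBall (simplexMap n a (spacings n y) j) ε) :=
        (measure_mono hsub).trans (measure_biUnion_finset_le _ _)
    _ = _ := by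
        simp_rw [Real.volume_closedBall, Finset.sum_const, nsmul_eq_mul]
        rw [← hcard, ENNReal.ofReal_mul (Nat.cast_nonneg _), ENNReal.ofReal_natCast]

/-! ### Mean deviation of the empirical distribution function -/

section Deviation

variable {m : ℕ} (μ : Measure ℝ)

/-- Deviation of the empirical distribution function of `y` from the distribution function
of `μ`. -/
def deviation (μ : Measure ℝ) (y : Fin m → ℝ) (t : ℝ) : ℝ := |count y t / m - μ.real (Iio t)|

lemma count_eq_sum (y : Fin m → ℝ) (t : ℝ) :
    (count y t : ℝ) = ∑ i, (Iio t).indicator (1 : ℝ → ℝ) (y i) := by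
  rw [count, Finset.card_filter]
  push_cast
  exact Finset.sum_congr rfl fun i _ => by simp [indicator_apply]

lemma measurable_count : Measurable fun p : (Fin m → ℝ) × ℝ => (count p.1 p.2 : ℝ) := by
  simp_rw [count_eq_sum, indicator_apply]
  refine Finset.measurable_sum _ fun i _ => ?_
  have h : MeasurableSet {p : (Fin m → ℝ) × ℝ | p.1 i ∈ Iio p.2} :=
    measurableSet_lt (f := fun p : (Fin m → ℝ) × ℝ => p.1 i) (g := fun p => p.2)
      (by fun_prop) (by fun_prop)
  exact Measurable.ite h measurable_const measurable_const

lemma deviation_nonneg (y : Fin m → ℝ) (t : ℝ) : 0 ≤ deviation μ y t := abs_nonneg _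

variable [IsProbabilityMeasure μ]

lemma monotone_cdf_measure : Monotone fun t => μ.real (Iio t) := fun _ _ h =>
  measureReal_mono (Iio_subset_Iio h)

lemma measurable_deviation :
    Measurable fun p : (Fin m → ℝ) × ℝ => deviation μ p.1 p.2 := by
  have h : Measurable fun p : (Fin m → ℝ) × ℝ => μ.real (Iio p.2) :=
    (monotone_cdf_measure μ).measurable.comp measurable_snd
  exact ((measurable_count.div_const _).sub h).abs

lemma deviation_le (y : Fin m → ℝ) (t : ℝ) : deviation μ y t ≤ 1 := by
  have h1 : (count y t : ℝ) / m ≤ 1 :=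
    div_le_one_of_le₀ (by exact_mod_cast count_le y t) (Nat.cast_nonneg _)
  have h2 : (0 : ℝ) ≤ count y t / m := by positivity
  have h3 : μ.real (Iio t) ≤ 1 := measureReal_le_one
  have h4 : 0 ≤ μ.real (Iio t) := measureReal_nonneg
  rw [deviation, abs_le]
  constructor <;> linarith

lemma integrable_deviation (t : ℝ) :
    Integrable (fun y => deviation μ y t) (Measure.pi fun _ : Fin m => μ) := by
  refine Integrable.of_bound
    ((measurable_deviation μ).comp measurable_prodMk_right).aestronglyMeasurable 1 ?_
  refine Eventually.of_forall fun y => ?_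
  rw [Real.norm_eq_abs, abs_of_nonneg (deviation_nonneg μ y t)]
  exact deviation_le μ y t

/-- The count is a sum of independent indicators, each of variance at most 1/4. A pointwise bound is
enough: the profile involves the empirical distribution only at one level and through an integral
over levels, so no uniform convergence is required. -/
lemma integral_deviation_le (hm : 0 < m) (t : ℝ) :
    ∫ y, deviation μ y t ∂(Measure.pi fun _ : Fin m => μ) ≤ 1 / √m := by
  set P := Measure.pi fun _ : Fin m => μ
  have hm' : (0 : ℝ) < m := by exact_mod_cast hm
  set f : ℝ → ℝ := (Iio t).indicator 1 with hf
  have hfm : Measurable f := measurable_one.indicator measurableSet_Iio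
  have hfb : ∀ u, f u ∈ Icc (0 : ℝ) 1 := fun u => by
    by_cases hu : u < t <;> simp [hf, hu]
  have hfL : MemLp f 2 μ := memLp_of_bounded (a := 0) (b := 1) (Eventually.of_forall hfb)
    hfm.aestronglyMeasurable 2
  have hfi : ∫ u, f u ∂μ = μ.real (Iio t) := integral_indicator_one measurableSet_Iio
  set S : (Fin m → ℝ) → ℝ := ∑ i, fun y => f (y i) with hS
  have hSy : ∀ y, S y = count y t := fun y => by
    rw [count_eq_sum, hS, Finset.sum_apply]
  have hSL : MemLp S 2 P := memLp_finsetSum' _ fun i _ =>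
    hfL.comp_measurePreserving (measurePreserving_eval _ i)
  have hvar : Var[S; P] ≤ m * (1 / 4) := by
    have h1 := variance_sum_pi (μ := fun _ : Fin m => μ) (X := fun _ => f) (fun _ => hfL)
    rw [← hS] at h1
    rw [h1]
    have h2 : Var[f; μ] ≤ ((1 - 0) / 2) ^ 2 :=
      variance_le_sq_of_bounded (Eventually.of_forall hfb) hfm.aemeasurable
    have h3 : ((1 - 0) / 2 : ℝ) ^ 2 = 1 / 4 := by norm_num
    rw [Finset.sum_const, Finset.card_univ, Fintype.card_fin, nsmul_eq_mul]
    exact mul_le_mul_of_nonneg_left (h3 ▸ h2) hm'.le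
  have hmean : ∫ y, S y ∂P = m * μ.real (Iio t) := by
    simp only [hS, Finset.sum_apply]
    rw [integral_finsetSum]
    · have : ∀ i : Fin m, ∫ y, f (y i) ∂P = μ.real (Iio t) := fun i => by
        rw [← hfi]
        conv_rhs => rw [← (measurePreserving_eval (fun _ : Fin m => μ) i).map_eq]
        rw [integral_map (measurable_pi_apply i).aemeasurable hfm.aestronglyMeasurable]
      simp [this]
    · exact fun i _ => (hfL.comp_measurePreserving
        (measurePreserving_eval (fun _ : Fin m => μ) i)).integrable (by norm_num)
  have hsq : ∀ y, deviation μ y t ^ 2 = (S y - ∫ y, S y ∂P) ^ 2 / m ^ 2 := fun y => by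
    rw [deviation, sq_abs, hmean, hSy]
    field_simp
  have hL2 : Integrable (fun y => deviation μ y t ^ 2) P := by
    simp_rw [hsq]
    exact (hSL.sub (memLp_const _)).integrable_sq.div_const _
  have hE : ∫ y, deviation μ y t ^ 2 ∂P ≤ 1 / (4 * m) := by
    simp_rw [hsq]
    rw [integral_div, ← variance_eq_integral hSL.aemeasurable, div_le_iff₀ (by positivity)]
    refine hvar.trans_eq ?_
    field_simp
  have hr : 0 < √(m : ℝ) := Real.sqrt_pos.2 hm'
  have hrr : √(m : ℝ) * √(m : ℝ) = m := Real.mul_self_sqrt hm'.le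
  -- From the second moment to the first through `d ≤ (√m d² + 1/√m)/2`.
  calc ∫ y, deviation μ y t ∂P
      ≤ ∫ y, (√m * deviation μ y t ^ 2 + 1 / √m) / 2 ∂P := by
        refine integral_mono (integrable_deviation μ t)
          (((hL2.const_mul _).add (integrable_const _)).div_const _) fun y => ?_
        have h1 : 0 ≤ √(m : ℝ) * (deviation μ y t - 1 / √m) ^ 2 := by positivity
        have h2 : √(m : ℝ) * (deviation μ y t - 1 / √m) ^ 2 =
            √m * deviation μ y t ^ 2 + 1 / √m - 2 * deviation μ y t := by
          field_simp
          ring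
        simp only
        linarith
    _ = (√m * ∫ y, deviation μ y t ^ 2 ∂P) / 2 + 1 / √m / 2 := by
        rw [integral_div, integral_add (hL2.const_mul _) (integrable_const _),
          integral_const_mul, integral_const, probReal_univ]
        simp
        ring
    _ ≤ 1 / √m := by
        have h1 : √(m : ℝ) * ∫ y, deviation μ y t ^ 2 ∂P ≤ √m * (1 / (4 * m)) :=
          mul_le_mul_of_nonneg_left hE hr.le
        have h2 : √(m : ℝ) * (1 / (4 * m)) = 1 / √m / 4 := by
          rw [← hrr]
          field_simp
          rw [Real.sqrt_sq hr.le]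
        have h3 : 0 < 1 / √(m : ℝ) := by positivity
        linarith

lemma integrable_deviation_prod :
    Integrable (fun p : (Fin m → ℝ) × ℝ => deviation μ p.1 p.2)
      ((Measure.pi fun _ : Fin m => μ).prod (volume.restrict (Ioc (0 : ℝ) 1))) := by
  refine Integrable.of_bound (measurable_deviation μ).aestronglyMeasurable 1 ?_
  refine Eventually.of_forall fun p => ?_
  rw [Real.norm_eq_abs, abs_of_nonneg (deviation_nonneg μ _ _)]
  exact deviation_le μ _ _

lemma integral_integral_deviation_le (hm : 0 < m) :
    ∫ y, (∫ t in Ioc (0 : ℝ) 1, deviation μ y t) ∂(Measure.pi fun _ : Fin m => μ) ≤ 1 / √m := by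
  have hint := integrable_deviation_prod (m := m) μ
  rw [integral_integral_swap (f := fun y t => deviation μ y t) hint]
  have h1 : Integrable (fun t => ∫ y, deviation μ y t ∂(Measure.pi fun _ : Fin m => μ))
      (volume.restrict (Ioc (0 : ℝ) 1)) :=
    Integrable.integral_prod_right (f := fun p : (Fin m → ℝ) × ℝ => deviation μ p.1 p.2) hint
  have hc : Integrable (fun _ : ℝ => 1 / √(m : ℝ)) (volume.restrict (Ioc (0 : ℝ) 1)) :=
    integrable_const _
  have h2 := integral_mono h1 hc fun t => integral_deviation_le μ hm t
  refine h2.trans_eq ?_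
  simp

end Deviation

/-! ### Closeness of the profile to its limit -/

section Profile

variable {g : ℝ → ℝ} {α : ℝ}

/-- Total deviation controlling the distance of the random profile from its limit. -/
def totalDeviation (g : ℝ → ℝ) (α a : ℝ) (n : ℕ) (y : Fin (n - 1) → ℝ) (s : ℝ) : ℝ :=
  (∫ t in Ioc (0 : ℝ) 1, deviation (sampleLaw g α) y t) +
    deviation (sampleLaw g α) y (excessCdf g α s) + |a - α| + 1 / n

lemma slope_eq {n : ℕ} (hn : 2 ≤ n) (a : ℝ) (k : ℕ) :
    slope n a k = (1 - a / 2) / (1 - k / n) := by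
  have : (n : ℝ) ≠ 0 := by positivity
  rw [slope, ← mul_div_mul_left (1 - a / 2) _ this]
  congr 1
  field_simp

lemma intervalIntegrable_deviation (μ : Measure ℝ) [IsProbabilityMeasure μ] {m : ℕ}
    (y : Fin m → ℝ) (s t : ℝ) : IntervalIntegrable (deviation μ y) volume s t := by
  have h1 : Monotone fun u => (count y u : ℝ) / m := fun u v huv =>
    div_le_div_of_nonneg_right (by exact_mod_cast count_mono y huv) (Nat.cast_nonneg _)
  exact (h1.intervalIntegrable.sub (monotone_cdf_measure μ).intervalIntegrable).abs

/-- Up to the level `H(s)` both `1 - F` and the empirical `1 - N` stay away from 0, by `q` and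
`q/2`, so the difference of the reciprocals is at most `2/q²` times the deviation. Replacing the
denominator `n - 1` by `n` costs `1/n`. -/
lemma abs_profile_sub_le (hg : Regular g α) {n : ℕ} (hn : 2 ≤ n) {a : ℝ}
    (ha : a < 2) (y : Fin (n - 1) → ℝ) {s q : ℝ} (hs : 0 ≤ s) (hq0 : 0 < q)
    (hq : q = 1 - cdf g s)
    (hd : deviation (sampleLaw g α) y (excessCdf g α s) ≤ q / 2) :
    |profile n a y (excessCdf g α s) - s| ≤ 2 / q ^ 2 * totalDeviation g α a n y s := by
  have := hg.isProbabilityMeasure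
  set μ := sampleLaw g α
  set η := excessCdf g α s with hη
  have hF : ∀ t, μ.real (Iio t) = sampleCdf g α t := fun t => rfl
  have hη0 : 0 ≤ η := hg.excessCdf_nonneg hs
  have hη1 : η ≤ 1 := hg.excessCdf_le_one s
  have hq1 : q ≤ 1 := by linarith [hg.cdf_nonneg hs]
  have hFη : sampleCdf g α η = 1 - q := by rw [hη, hg.sampleCdf_excessCdf hs]; linarith
  have hn1 : (2 : ℝ) ≤ n := by exact_mod_cast hn
  have hcast : ((n - 1 : ℕ) : ℝ) = n - 1 := by
    rw [Nat.cast_sub (by omega)]; simp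
  have hM : ∀ t, (count y t : ℝ) / n ≤ count y t / ((n - 1 : ℕ) : ℝ) := fun t => by
    rw [hcast]
    apply div_le_div_of_nonneg_left (by positivity) <;> linarith
  have hM' : ∀ t, (count y t : ℝ) / ((n - 1 : ℕ) : ℝ) - count y t / n ≤ 1 / n := fun t => by
    have h1 : (count y t : ℝ) ≤ n - 1 := by rw [← hcast]; exact_mod_cast count_le y t
    have h2 : (count y t : ℝ) / ((n - 1 : ℕ) : ℝ) - count y t / n =
        count y t / ((n : ℝ) - 1) * (1 / n) := by
      rw [hcast]
      have : (n : ℝ) - 1 ≠ 0 := by linarith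
      field_simp
      ring
    rw [h2]
    exact mul_le_of_le_one_left (by positivity) (div_le_one_of_le₀ h1 (by linarith))
  have hdev : ∀ t, |(count y t : ℝ) / n - sampleCdf g α t| ≤ deviation μ y t + 1 / n := by
    intro t
    have h1 := abs_sub_abs_le_abs_sub ((count y t : ℝ) / n - sampleCdf g α t)
      ((count y t : ℝ) / ((n - 1 : ℕ) : ℝ) - sampleCdf g α t)
    rw [sub_sub_sub_cancel_right, abs_sub_comm ((count y t : ℝ) / n) (count y t / ((n - 1 : ℕ) : ℝ)),
      abs_of_nonneg (sub_nonneg.2 (hM t))] at h1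
    have h2 := hM' t
    rw [deviation, hF]
    linarith
  have hNη : (count y η : ℝ) / ((n - 1 : ℕ) : ℝ) ≤ 1 - q / 2 := by
    have h1 := (abs_le.1 hd).2
    rw [hF, hFη] at h1
    linarith
  have hpt : ∀ t ∈ Icc 0 η, |slope n a (count y t) - (1 - α / 2) * (1 / (1 - sampleCdf g α t))| ≤
      |a - α| / q + 2 / q ^ 2 * (deviation μ y t + 1 / n) := by
    intro t ht
    set N := (count y t : ℝ) / n
    set F := sampleCdf g α t
    have hN : q / 2 ≤ 1 - N := by
      have h1 : (count y t : ℝ) / ((n - 1 : ℕ) : ℝ) ≤ count y η / ((n - 1 : ℕ) : ℝ) := by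
        gcongr
        exact count_mono y ht.2
      linarith [hM t]
    have hFt : q ≤ 1 - F := by
      have := monotone_cdf_measure μ ht.2
      simp only [hF, hFη] at this
      linarith
    have hdt : |N - F| ≤ deviation μ y t + 1 / n := hdev t
    have hsl : slope n a (count y t) = (1 - a / 2) / (1 - N) := slope_eq hn a _
    clear_value N F
    have hN0 : 0 < 1 - N := by linarith
    have hF0 : 0 < 1 - F := by linarith
    have h1 : slope n a (count y t) - (1 - α / 2) * (1 / (1 - F)) =
        (α - a) / 2 * (1 / (1 - N)) + (1 - α / 2) * ((N - F) * (1 / (1 - N)) * (1 / (1 - F))) := by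
      rw [hsl]
      field_simp
      ring
    have hiN : 1 / (1 - N) ≤ 2 / q := by
      rw [div_le_div_iff₀ hN0 hq0]; linarith
    have hiF : 1 / (1 - F) ≤ 1 / q := one_div_le_one_div_of_le hq0 hFt
    have hα := hg.half_pos
    have hα1 : 1 - α / 2 ≤ 1 := by linarith [hg.pos]
    rw [h1]
    refine (abs_add_le _ _).trans (add_le_add ?_ ?_)
    · rw [abs_mul, abs_of_pos (show 0 < 1 / (1 - N) by positivity), abs_div, abs_sub_comm, abs_two]
      calc |a - α| / 2 * (1 / (1 - N)) ≤ |a - α| / 2 * (2 / q) := by gcongr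
        _ = |a - α| / q := by field_simp
    · rw [abs_mul, abs_mul, abs_mul, abs_of_pos hα, abs_of_pos (show 0 < 1 / (1 - N) by positivity),
        abs_of_pos (show 0 < 1 / (1 - F) by positivity)]
      calc (1 - α / 2) * (|N - F| * (1 / (1 - N)) * (1 / (1 - F)))
          ≤ 1 * ((deviation μ y t + 1 / n) * (2 / q) * (1 / q)) := by
            have := deviation_nonneg μ y t
            gcongr
        _ = 2 / q ^ 2 * (deviation μ y t + 1 / n) := by field_simp
  have hFint : IntervalIntegrable (fun t => (1 - α / 2) * (1 / (1 - sampleCdf g α t))) volume 0 η := by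
    refine IntervalIntegrable.const_mul (MonotoneOn.intervalIntegrable fun u hu v hv huv => ?_) _
    rw [uIcc_of_le hη0] at hu hv
    have h1 : ∀ w ≤ η, sampleCdf g α w ≤ 1 - q := fun w hw => by
      rw [← hFη]; exact monotone_cdf_measure μ hw
    have h2 : sampleCdf g α u ≤ sampleCdf g α v := monotone_cdf_measure μ huv
    apply one_div_le_one_div_of_le
    · linarith [h1 v hv.2]
    · linarith
  have hsint := slope_count_intervalIntegrable hn ha y 0 η
  have hdint := intervalIntegrable_deviation μ y 0 η
  have hint : |(∫ t in (0 : ℝ)..η, slope n a (count y t)) - (s - α * cdf g s)| ≤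
      |a - α| / q + 2 / q ^ 2 * ((∫ t in Ioc (0 : ℝ) 1, deviation μ y t) + 1 / n) := by
    rw [← hg.integral_inv_sampleCdf hs (by linarith), ← intervalIntegral.integral_const_mul,
      ← intervalIntegral.integral_sub hsint hFint]
    calc _ ≤ ∫ t in (0 : ℝ)..η,
          |slope n a (count y t) - (1 - α / 2) * (1 / (1 - sampleCdf g α t))| :=
          intervalIntegral.abs_integral_le_integral_abs hη0
      _ ≤ ∫ t in (0 : ℝ)..η, (|a - α| / q + 2 / q ^ 2 * (deviation μ y t + 1 / n)) := by
          refine intervalIntegral.integral_mono_on hη0 (hsint.sub hFint).abs ?_ hpt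
          exact intervalIntegrable_const.add
            ((hdint.add intervalIntegrable_const).const_mul _)
      _ ≤ ∫ t in (0 : ℝ)..1, (|a - α| / q + 2 / q ^ 2 * (deviation μ y t + 1 / n)) := by
          refine intervalIntegral.integral_mono_interval le_rfl hη0 hη1
            (Eventually.of_forall fun t => ?_) ?_
          · have := deviation_nonneg μ y t
            simp only [Pi.zero_apply]
            positivity
          · exact intervalIntegrable_const.add
              (((intervalIntegrable_deviation μ y 0 1).add intervalIntegrable_const).const_mul _)
      _ = _ := by
          have h1 := intervalIntegrable_deviation μ y 0 1
          rw [intervalIntegral.integral_add intervalIntegrable_const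
            ((h1.add intervalIntegrable_const).const_mul _), intervalIntegral.integral_const_mul,
            intervalIntegral.integral_add h1 intervalIntegrable_const,
            ← intervalIntegral.integral_of_le zero_le_one, intervalIntegral.integral_const,
            intervalIntegral.integral_const]
          simp
  have hcnt : |a / ((n : ℝ) - 1) * count y η - α * cdf g s| ≤ |a - α| + 2 * deviation μ y η := by
    set M := (count y η : ℝ) / ((n - 1 : ℕ) : ℝ) with hMdef
    have hM1 : M ≤ 1 := by linarith
    have hM0 : 0 ≤ M := by positivity
    have h1 : a / ((n : ℝ) - 1) * count y η - α * cdf g s = (a - α) * M + α * (M - (1 - q)) := by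
      rw [hMdef, hcast, hq]; ring
    have h2 : deviation μ y η = |M - (1 - q)| := by rw [deviation, hF, hFη]
    rw [h1, h2]
    refine (abs_add_le _ _).trans (add_le_add ?_ ?_)
    · rw [abs_mul, abs_of_nonneg hM0]
      exact mul_le_of_le_one_right (abs_nonneg _) hM1
    · rw [abs_mul, abs_of_pos hg.pos]
      exact mul_le_mul_of_nonneg_right hg.lt_two.le (abs_nonneg _)
  have h1 : profile n a y η - s = ((∫ t in (0 : ℝ)..η, slope n a (count y t)) - (s - α * cdf g s)) +
      (a / ((n : ℝ) - 1) * count y η - α * cdf g s) := by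
    rw [profile]; ring
  have h2 : |a - α| / q + |a - α| ≤ 2 / q ^ 2 * |a - α| := by
    have h3 : 1 / q ≤ 1 / q ^ 2 := one_div_le_one_div_of_le (by positivity) (by nlinarith)
    have h4 : 1 ≤ 1 / q ^ 2 := by
      rw [le_div_iff₀ (by positivity)]; nlinarith
    have h5 : |a - α| / q + |a - α| = (1 / q + 1) * |a - α| := by ring
    rw [h5]
    refine mul_le_mul_of_nonneg_right ?_ (abs_nonneg _)
    calc 1 / q + 1 ≤ 1 / q ^ 2 + 1 / q ^ 2 := add_le_add h3 h4
      _ = 2 / q ^ 2 := by ring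
  have h6 : 2 * deviation μ y η ≤ 2 / q ^ 2 * deviation μ y η := by
    refine mul_le_mul_of_nonneg_right ?_ (deviation_nonneg μ y η)
    rw [le_div_iff₀ (by positivity)]
    nlinarith
  rw [h1]
  refine (abs_add_le _ _).trans ((add_le_add hint hcnt).trans ?_)
  rw [totalDeviation]
  linarith

end Profile

/-! ### Reduction to expectations over the sample points -/

section Law

/-- The sorting permutation takes finitely many values, and the event of each value is described by
finitely many comparisons of coordinates. -/
lemma measurable_orderStat {m : ℕ} (k : ℕ) : Measurable fun y : Fin m → ℝ => orderStat y k := by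
  cases k with
  | zero => exact measurable_const
  | succ k =>
    by_cases hk : k < m
    · simp only [orderStat, hk, dif_pos]
      have hsort : ∀ σ : Equiv.Perm (Fin m), MeasurableSet {y : Fin m → ℝ | Tuple.sort y = σ} := by
        intro σ
        have : {y : Fin m → ℝ | Tuple.sort y = σ} =
            (⋂ i, ⋂ j, {y | i ≤ j → y (σ i) ≤ y (σ j)}) ∩
              ⋂ i, ⋂ j, {y | i < j → y (σ i) = y (σ j) → σ i < σ j} := by
          ext y
          simp only [mem_ofPred_eq, mem_inter_iff, mem_iInter]
          rw [eq_comm, Tuple.eq_sort_iff]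
          exact Iff.rfl
        rw [this]
        refine (MeasurableSet.iInter fun i => MeasurableSet.iInter fun j => ?_).inter
          (MeasurableSet.iInter fun i => MeasurableSet.iInter fun j => ?_)
        · exact (MeasurableSet.const _).imp
            (measurableSet_le (measurable_pi_apply _) (measurable_pi_apply _))
        · exact (MeasurableSet.const _).imp
            ((measurableSet_eq_fun (measurable_pi_apply (σ i)) (measurable_pi_apply (σ j))).imp
              (MeasurableSet.const _))
      intro S hS
      have : (fun y : Fin m → ℝ => y (Tuple.sort y ⟨k, hk⟩)) ⁻¹' S =
          ⋃ σ : Equiv.Perm (Fin m), {y | Tuple.sort y = σ} ∩ (fun y => y (σ ⟨k, hk⟩)) ⁻¹' S := by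
        ext y
        simp
      rw [this]
      exact MeasurableSet.iUnion fun σ => (hsort σ).inter (measurable_pi_apply _ hS)
    · simp only [orderStat, hk, dif_neg, not_false_eq_true]
      exact measurable_const

lemma measurable_spacings (n : ℕ) : Measurable (spacings n) :=
  measurable_pi_lambda _ fun _ => (measurable_orderStat _).sub (measurable_orderStat _)

lemma measurable_simplexMap (n : ℕ) (a : ℝ) : Measurable (simplexMap n a) := by
  unfold simplexMap
  fun_prop

lemma measurableSet_admissible (n : ℕ) (a : ℝ) :
    MeasurableSet {p : (Fin n → ℝ) × ℝ | Admissible n a p.1 p.2} := by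
  simp only [Admissible, ofPred_forall]
  exact MeasurableSet.iInter fun j => measurableSet_lt (by fun_prop) (by fun_prop)

lemma admissible_comp_perm {n : ℕ} (a : ℝ) (z : Fin n → ℝ) (σ : Equiv.Perm (Fin n)) (u : ℝ) :
    Admissible n a (z ∘ σ) u ↔ Admissible n a z u :=
  ⟨fun h j => by simpa using h (σ.symm j), fun h j => h (σ j)⟩

lemma lintegral_symmetrize {n : ℕ} (ν : Measure (Fin n → ℝ)) {f : (Fin n → ℝ) → ℝ≥0∞}
    (hf : Measurable f) (hσ : ∀ (σ : Equiv.Perm (Fin n)) z, f (z ∘ σ) = f z) :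
    ∫⁻ z, f z ∂symmetrize ν = ∫⁻ z, f z ∂ν := by
  have h1 : ∀ σ : Equiv.Perm (Fin n), ∫⁻ z, f z ∂(ν.map fun x => x ∘ σ) = ∫⁻ z, f z ∂ν := by
    intro σ
    rw [lintegral_map hf (measurable_pi_lambda _ fun i => measurable_pi_apply _)]
    simp_rw [hσ]
  rw [symmetrize, lintegral_smul_measure, lintegral_finsetSum_measure]
  simp_rw [h1]
  rw [Finset.sum_const, Finset.card_univ, Fintype.card_perm, Fintype.card_fin, smul_eq_mul,
    nsmul_eq_mul, ← mul_assoc, ENNReal.inv_mul_cancel (by simp [Nat.factorial_ne_zero])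
      (ENNReal.natCast_ne_top _), one_mul]

/-- Length of the set of admissible positions in `[x, x + δ]`. -/
def freeLength (n : ℕ) (a x δ : ℝ) (y : Fin (n - 1) → ℝ) : ℝ≥0∞ :=
  volume ({u | Admissible n a (simplexMap n a (spacings n y)) u} ∩ Icc x (x + δ))

lemma measurable_freeLength_aux (n : ℕ) (a x δ : ℝ) :
    Measurable fun z : Fin n → ℝ => volume.restrict (Icc x (x + δ)) {u | Admissible n a z u} :=
  measurable_measure_prodMk_left (measurableSet_admissible n a)

lemma freeLength_eq (n : ℕ) (a x δ : ℝ) (y : Fin (n - 1) → ℝ) :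
    freeLength n a x δ y = volume.restrict (Icc x (x + δ))
      {u | Admissible n a (simplexMap n a (spacings n y)) u} :=
  (Measure.restrict_apply' measurableSet_Icc).symm

lemma measurable_freeLength (n : ℕ) (a x δ : ℝ) : Measurable (freeLength n a x δ) := by
  have := (measurable_freeLength_aux n a x δ).comp
    ((measurable_simplexMap n a).comp (measurable_spacings n))
  convert! this using 1
  ext y
  rw [freeLength_eq]
  rfl

lemma freeLength_le (n : ℕ) (a x δ : ℝ) (y : Fin (n - 1) → ℝ) :
    freeLength n a x δ y ≤ ENNReal.ofReal δ :=
  (measure_mono inter_subset_right).trans_eq (by simp)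

/-- Integrate out the uniform point first. Admissibility does not depend on the labelling of the
particles, so the average over permutations disappears. -/
lemma admissibleProb_eq (g : ℝ → ℝ) (α : ℝ) (n : ℕ) (a x δ : ℝ) :
    admissibleProb g α n a x δ = ((ENNReal.ofReal δ)⁻¹ *
      ∫⁻ y, freeLength n a x δ y ∂(Measure.pi fun _ : Fin (n - 1) => sampleLaw g α)).toReal := by
  rw [admissibleProb, measureReal_def, Measure.prod_apply (measurableSet_admissible n a)]
  have h1 : ∀ z : Fin n → ℝ, ProbabilityTheory.cond volume (Icc x (x + δ))
      (Prod.mk z ⁻¹' {p | Admissible n a p.1 p.2}) =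
      (ENNReal.ofReal δ)⁻¹ * volume.restrict (Icc x (x + δ)) {u | Admissible n a z u} := by
    intro z
    rw [ProbabilityTheory.cond, Measure.smul_apply, Real.volume_Icc, add_sub_cancel_left]
    rfl
  simp_rw [h1]
  have hm := measurable_freeLength_aux n a x δ
  rw [lintegral_const_mul _ hm, configLaw, lintegral_symmetrize _ hm,
    Measure.map_map (measurable_simplexMap n a) (measurable_spacings n),
    lintegral_map hm ((measurable_simplexMap n a).comp (measurable_spacings n))]
  · simp_rw [freeLength_eq]
    rfl
  · intro σ z
    congr 1
    ext u
    exact admissible_comp_perm a z σ u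

/-- By Fubini, fix the level `η`: the `m` independent points all have to avoid one interval. -/
lemma lintegral_voidSet (μ : Measure ℝ) [IsProbabilityMeasure μ] (m : ℕ) (s t ℓ : ℝ) :
    ∫⁻ y, volume (voidSet y s t ℓ) ∂(Measure.pi fun _ : Fin m => μ) =
      ∫⁻ η in Ioo s t, ENNReal.ofReal ((1 - μ.real (Ico η (η + ℓ))) ^ m) := by
  have hm := measurableSet_voidSet (m := m) s t ℓ
  have h1 := Measure.prod_apply (μ := Measure.pi fun _ : Fin m => μ) (ν := volume) hm
  have h2 := Measure.prod_apply_symm (μ := Measure.pi fun _ : Fin m => μ) (ν := volume) hm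
  have h3 : ∀ η, (Measure.pi fun _ : Fin m => μ)
      ((fun y => (y, η)) ⁻¹' {p : (Fin m → ℝ) × ℝ | p.2 ∈ voidSet p.1 s t ℓ}) =
      (Ioo s t).indicator (fun η => ENNReal.ofReal ((1 - μ.real (Ico η (η + ℓ))) ^ m)) η := by
    intro η
    by_cases hη : η ∈ Ioo s t
    · have h4 : ((fun y => (y, η)) ⁻¹' {p : (Fin m → ℝ) × ℝ | p.2 ∈ voidSet p.1 s t ℓ}) =
          Set.univ.pi fun _ => (Ico η (η + ℓ))ᶜ := by
        ext y
        simp only [voidSet, mem_preimage, mem_ofPred_eq, hη, true_and, Set.mem_pi, mem_univ,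
          forall_const, mem_compl_iff]
      rw [indicator_of_mem hη, h4, Measure.pi_pi, Finset.prod_const, Finset.card_univ,
        Fintype.card_fin, ← probReal_compl_eq_one_sub measurableSet_Ico,
        ENNReal.ofReal_pow measureReal_nonneg, ofReal_measureReal]
    · rw [indicator_of_notMem hη]
      have h4 : ((fun y => (y, η)) ⁻¹' {p : (Fin m → ℝ) × ℝ | p.2 ∈ voidSet p.1 s t ℓ}) = ∅ :=
        eq_empty_of_forall_notMem fun y hy => hη hy.1
      rw [h4, measure_empty]
  simp_rw [h3] at h2
  rw [lintegral_indicator measurableSet_Ioo] at h2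
  rw [← h2, h1]
  rfl

lemma measurable_volume_voidSet {m : ℕ} (s t ℓ : ℝ) :
    Measurable fun y : Fin m → ℝ => volume (voidSet y s t ℓ) :=
  measurable_measure_prodMk_left (measurableSet_voidSet s t ℓ)

lemma ae_mem_Icc {g : ℝ → ℝ} {α : ℝ} (hg : Regular g α) (m : ℕ) :
    ∀ᵐ y ∂(Measure.pi fun _ : Fin m => sampleLaw g α), ∀ i, y i ∈ Icc (0 : ℝ) 1 := by
  have := hg.isProbabilityMeasure
  rw [ae_all_iff]
  intro i
  exact (measurePreserving_eval (fun _ : Fin m => sampleLaw g α) i).quasiMeasurePreserving.ae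
    (ae_sampleLaw_mem_Icc g α)

/-- Bound on the expected total deviation. -/
def deviationBound (α a : ℝ) (n : ℕ) : ℝ := 2 / √((n - 1 : ℕ) : ℝ) + |a - α| + 1 / n

lemma measure_totalDeviation_ge {g : ℝ → ℝ} {α : ℝ} (hg : Regular g α) {n : ℕ} (hn : 2 ≤ n)
    (a s : ℝ) {κ : ℝ} (hκ : 0 < κ) :
    (Measure.pi fun _ : Fin (n - 1) => sampleLaw g α) {y | κ ≤ totalDeviation g α a n y s} ≤
      ENNReal.ofReal (deviationBound α a n / κ) := by
  have := hg.isProbabilityMeasure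
  set μ := sampleLaw g α
  set P := Measure.pi fun _ : Fin (n - 1) => μ
  have hm : 0 < n - 1 := by omega
  have i1 : Integrable (fun y : Fin (n - 1) → ℝ => ∫ t in Ioc (0 : ℝ) 1, deviation μ y t) P :=
    Integrable.integral_prod_left (f := fun p : (Fin (n - 1) → ℝ) × ℝ => deviation μ p.1 p.2)
      (integrable_deviation_prod μ)
  have i2 : Integrable (fun y : Fin (n - 1) → ℝ => deviation μ y (excessCdf g α s)) P :=
    integrable_deviation μ _
  have i12 : Integrable (fun y : Fin (n - 1) → ℝ => (∫ t in Ioc (0 : ℝ) 1, deviation μ y t) +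
      deviation μ y (excessCdf g α s)) P := i1.add i2
  have i12' : Integrable (fun y : Fin (n - 1) → ℝ => (∫ t in Ioc (0 : ℝ) 1, deviation μ y t) +
      deviation μ y (excessCdf g α s) + |a - α|) P := i12.add (integrable_const _)
  have i3 : Integrable (fun y => totalDeviation g α a n y s) P := i12'.add (integrable_const _)
  have hnn : ∀ y, 0 ≤ totalDeviation g α a n y s := fun y => by
    have h1 : 0 ≤ ∫ t in Ioc (0 : ℝ) 1, deviation μ y t :=
      integral_nonneg fun t => deviation_nonneg μ y t
    have h2 := deviation_nonneg μ y (excessCdf g α s)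
    have h3 : (0 : ℝ) ≤ 1 / n := by positivity
    have h4 := abs_nonneg (a - α)
    rw [totalDeviation]
    linarith
  have hE : ∫ y, totalDeviation g α a n y s ∂P ≤ deviationBound α a n := by
    have h1 : ∫ y, totalDeviation g α a n y s ∂P =
        (∫ y, (∫ t in Ioc (0 : ℝ) 1, deviation μ y t) ∂P) +
          (∫ y, deviation μ y (excessCdf g α s) ∂P) + |a - α| + 1 / n := by
      unfold totalDeviation
      rw [integral_add i12' (integrable_const _), integral_add i12 (integrable_const _),
        integral_add i1 i2]
      simp
    have h2 := integral_integral_deviation_le μ hm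
    have h3 := integral_deviation_le μ hm (excessCdf g α s)
    rw [h1, deviationBound]
    have h4 : 2 / √((n - 1 : ℕ) : ℝ) = 1 / √((n - 1 : ℕ) : ℝ) + 1 / √((n - 1 : ℕ) : ℝ) := by ring
    rw [h4]
    gcongr
  have hmk := mul_meas_ge_le_integral_of_nonneg (Eventually.of_forall hnn) i3 κ
  rw [← ofReal_measureReal]
  refine ENNReal.ofReal_le_ofReal ?_
  rw [le_div_iff₀ hκ, mul_comm]
  exact hmk.trans hE

end Law

/-! ### Bounds on the probability for fixed `n` -/

section FiniteBounds

variable {g : ℝ → ℝ} {α : ℝ}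

/-- `r` is the tolerance in position and `κ` the threshold on the deviation. Allowing any `q ≤ 1 -
G(s)` lets one constant, taken at the right end of a window, serve both ends. -/
lemma profile_close (hg : Regular g α) {n : ℕ} (hn : 2 ≤ n) {a : ℝ} (ha : a < 2)
    {y : Fin (n - 1) → ℝ} {s q r κ : ℝ} (hs : 0 ≤ s) (hq0 : 0 < q) (hq : q ≤ 1 - cdf g s)
    (hr : r ≤ 1) (hκ : κ ≤ q ^ 2 * r / 2) (hy : totalDeviation g α a n y s < κ) :
    |profile n a y (excessCdf g α s) - s| ≤ r ∧
      |(count y (excessCdf g α s) : ℝ) / ((n - 1 : ℕ) : ℝ) - cdf g s| ≤ κ := by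
  have := hg.isProbabilityMeasure
  set q' := 1 - cdf g s with hq'
  have hq1 : q' ≤ 1 := by linarith [hg.cdf_nonneg hs]
  have hqq : q ^ 2 ≤ q' ^ 2 := pow_le_pow_left₀ hq0.le hq 2
  have hd : deviation (sampleLaw g α) y (excessCdf g α s) ≤ totalDeviation g α a n y s := by
    have h1 : 0 ≤ ∫ t in Ioc (0 : ℝ) 1, deviation (sampleLaw g α) y t :=
      integral_nonneg fun t => deviation_nonneg _ y t
    have h3 : (0 : ℝ) ≤ 1 / n := by positivity
    have h4 := abs_nonneg (a - α)
    rw [totalDeviation]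
    linarith
  have hd0 := deviation_nonneg (sampleLaw g α) y (excessCdf g α s)
  have hr0 : 0 < r := by
    by_contra hcon
    have : q ^ 2 * r ≤ 0 := mul_nonpos_of_nonneg_of_nonpos (by positivity) (not_lt.1 hcon)
    linarith
  have hκ' : κ ≤ q' ^ 2 * r / 2 :=
    hκ.trans (by gcongr)
  have hq2 : q' ^ 2 * r ≤ q' := by
    have : q' ^ 2 * r ≤ q' ^ 2 * 1 := by gcongr
    nlinarith
  refine ⟨?_, ?_⟩
  · refine (abs_profile_sub_le hg hn ha y hs (hq0.trans_le hq) hq' (by linarith)).trans ?_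
    rw [div_mul_eq_mul_div, div_le_iff₀ (by have := hq0.trans_le hq; positivity)]
    linarith
  · rw [deviation, show (sampleLaw g α).real (Iio (excessCdf g α s)) = cdf g s from
      hg.sampleCdf_excessCdf hs] at hd
    linarith

/-- Off an event controlled by Markov's inequality at the two levels, the profile brackets the
window and the comparison with voids applies. On that event the free length is at most `δ`. -/
lemma admissibleProb_le (hg : Regular g α) {n : ℕ} (hn : 2 ≤ n) {a : ℝ} (ha0 : 0 < a) (ha : a < 2)
    {x δ s t r κ σ ℓ p : ℝ} (hx : 0 ≤ x) (hδ : 0 < δ) (hs : 0 ≤ s) (hst : s ≤ t)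
    (ht : cdf g t + κ < 1)
    (hr : r ≤ 1) (hκ0 : 0 < κ) (hκ : κ ≤ (1 - cdf g t) ^ 2 * r / 2)
    (hsx : s = 0 ∨ s + r ≤ x) (htx : x + δ + r ≤ t)
    (hσ : σ = (1 - a / 2) / (1 - (cdf g t + κ))) (hℓ : ℓ * σ ≤ a / ((n : ℝ) - 1))
    (hp : ∀ η ∈ Ioo (excessCdf g α s) (excessCdf g α t), p ≤ (sampleLaw g α).real (Ico η (η + ℓ)))
    (hp1 : p ≤ 1) :
    admissibleProb g α n a x δ ≤ 2 * (deviationBound α a n / κ) +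
      σ * ((excessCdf g α t - excessCdf g α s) * (1 - p) ^ (n - 1)) / δ := by
  have := hg.isProbabilityMeasure
  set P := Measure.pi fun _ : Fin (n - 1) => sampleLaw g α with hP
  set bad : Set (Fin (n - 1) → ℝ) :=
    {y | κ ≤ totalDeviation g α a n y s} ∪ {y | κ ≤ totalDeviation g α a n y t} with hbad
  have hB0 : 0 ≤ deviationBound α a n := by unfold deviationBound; positivity
  have hσ0 : 0 ≤ σ := by rw [hσ]; apply div_nonneg <;> linarith
  have hH := hg.mono_excessCdf hst
  have hcast : ((n - 1 : ℕ) : ℝ) = n - 1 := by rw [Nat.cast_sub (by omega)]; simp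
  have hn1 : (2 : ℝ) ≤ n := by exact_mod_cast hn
  have hPbad : P bad ≤ ENNReal.ofReal (2 * (deviationBound α a n / κ)) := by
    refine (measure_union_le _ _).trans ?_
    rw [two_mul, ENNReal.ofReal_add (by positivity) (by positivity)]
    exact add_le_add (measure_totalDeviation_ge hg hn a s hκ0)
      (measure_totalDeviation_ge hg hn a t hκ0)
  have hpt : ∀ᵐ y ∂P, freeLength n a x δ y ≤ bad.indicator (fun _ => ENNReal.ofReal δ) y +
      ENNReal.ofReal σ * volume (voidSet y (excessCdf g α s) (excessCdf g α t) ℓ) := by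
    filter_upwards [ae_mem_Icc hg (n - 1)] with y hy
    by_cases hyb : y ∈ bad
    · rw [indicator_of_mem hyb]
      exact (freeLength_le n a x δ y).trans le_self_add
    · rw [indicator_of_notMem hyb, zero_add]
      simp only [hbad, mem_union, mem_ofPred_eq, not_or, not_le] at hyb
      have hgt : cdf g s ≤ cdf g t := hg.mono_cdf hst
      obtain ⟨ht1, ht2⟩ := profile_close hg hn ha (hs.trans hst) (by linarith) le_rfl hr hκ hyb.2
      obtain ⟨hs1, -⟩ := profile_close hg hn ha hs (q := 1 - cdf g t) (by linarith) (by linarith)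
        hr hκ hyb.1
      refine volume_admissible_le hn ha0 ha hy hx (hg.excessCdf_nonneg (hs.trans hst))
        (hg.excessCdf_le_one t) ?_ ?_ ?_ hℓ
      -- Near the origin there is no room for a margin on the left, but at `s = 0` the profile is
      -- exactly 0.
      · rcases hsx with rfl | hsx
        · have h1 : count y 0 = 0 := by
            rw [count, Finset.card_eq_zero, Finset.filter_eq_empty_iff]
            exact fun i _ => not_lt.2 (hy i).1
          simp only [excessCdf, cdf_zero, profile, intervalIntegral.integral_same, h1,
            Nat.cast_zero, mul_zero, add_zero]
          exact hx
        · have := (abs_le.1 hs1).2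
          linarith
      · have := (abs_le.1 ht1).1
        linarith
      · rw [slope_eq hn, hσ]
        have h2 := (abs_le.1 ht2).2
        have h3 : (count y (excessCdf g α t) : ℝ) / n ≤
            count y (excessCdf g α t) / ((n - 1 : ℕ) : ℝ) := by
          rw [hcast]
          apply div_le_div_of_nonneg_left (by positivity) <;> linarith
        apply div_le_div_of_nonneg_left <;> linarith
  have hvoid : ∫⁻ y, volume (voidSet y (excessCdf g α s) (excessCdf g α t) ℓ) ∂P ≤
      ENNReal.ofReal ((excessCdf g α t - excessCdf g α s) * (1 - p) ^ (n - 1)) := by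
    rw [hP, lintegral_voidSet]
    calc _ ≤ ∫⁻ _ in Ioo (excessCdf g α s) (excessCdf g α t),
          ENNReal.ofReal ((1 - p) ^ (n - 1)) := by
          refine setLIntegral_mono measurable_const fun η hη => ENNReal.ofReal_le_ofReal ?_
          have h1 : (sampleLaw g α).real (Ico η (η + ℓ)) ≤ 1 := measureReal_le_one
          have h2 := hp η hη
          exact pow_le_pow_left₀ (by linarith) (by linarith) _
      _ = _ := by
          rw [setLIntegral_const, Real.volume_Ioo, mul_comm,
            ENNReal.ofReal_mul (sub_nonneg.2 hH)]
  have hint : ∫⁻ y, freeLength n a x δ y ∂P ≤ ENNReal.ofReal (δ * (2 * (deviationBound α a n / κ)) +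
      σ * ((excessCdf g α t - excessCdf g α s) * (1 - p) ^ (n - 1))) := by
    have h1p : 0 ≤ 1 - p := by linarith
    have hHs := sub_nonneg.2 hH
    calc _ ≤ _ := lintegral_mono_ae hpt
      _ = ∫⁻ y, bad.indicator (fun _ => ENNReal.ofReal δ) y ∂P + ENNReal.ofReal σ *
          ∫⁻ y, volume (voidSet y (excessCdf g α s) (excessCdf g α t) ℓ) ∂P := by
          rw [lintegral_add_right _ ((measurable_volume_voidSet _ _ _).const_mul _),
            lintegral_const_mul _ (measurable_volume_voidSet _ _ _)]
      _ ≤ ENNReal.ofReal δ * ENNReal.ofReal (2 * (deviationBound α a n / κ)) + ENNReal.ofReal σ *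
          ENNReal.ofReal ((excessCdf g α t - excessCdf g α s) * (1 - p) ^ (n - 1)) := by
          refine add_le_add ((lintegral_indicator_const_le _ _).trans ?_) ?_
          · gcongr
          · gcongr
      _ = _ := by
          rw [ENNReal.ofReal_add (by positivity) (by positivity), ENNReal.ofReal_mul hδ.le,
            ENNReal.ofReal_mul hσ0]
  rw [admissibleProb_eq]
  have h1p : 0 ≤ 1 - p := by linarith
  have hHs := sub_nonneg.2 hH
  refine ENNReal.toReal_le_of_le_ofReal (by positivity) ?_
  calc _ ≤ (ENNReal.ofReal δ)⁻¹ * ENNReal.ofReal (δ * (2 * (deviationBound α a n / κ)) +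
      σ * ((excessCdf g α t - excessCdf g α s) * (1 - p) ^ (n - 1))) := by gcongr
    _ = _ := by
        rw [← ENNReal.ofReal_inv_of_pos hδ, ← ENNReal.ofReal_mul (by positivity)]
        congr 1
        field_simp

lemma lintegral_freeLength_eq (hg : Regular g α) (n : ℕ) (a x : ℝ) {δ : ℝ} (hδ : 0 < δ) :
    ∫⁻ y, freeLength n a x δ y ∂(Measure.pi fun _ : Fin (n - 1) => sampleLaw g α) =
      ENNReal.ofReal (δ * admissibleProb g α n a x δ) := by
  have := hg.isProbabilityMeasure
  have h1 : ∫⁻ y, freeLength n a x δ y ∂(Measure.pi fun _ : Fin (n - 1) => sampleLaw g α) ≤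
      ENNReal.ofReal δ := by
    refine (lintegral_mono (freeLength_le n a x δ)).trans_eq ?_
    simp
  rw [admissibleProb_eq, ENNReal.ofReal_mul hδ.le, ENNReal.ofReal_toReal, ← mul_assoc,
    ENNReal.mul_inv_cancel (by simpa using hδ) ENNReal.ofReal_ne_top, one_mul]
  exact ENNReal.mul_ne_top (by simpa using hδ) (h1.trans_lt ENNReal.ofReal_lt_top).ne

lemma admissibleProb_nonneg (g : ℝ → ℝ) (α : ℝ) (n : ℕ) (a x δ : ℝ) :
    0 ≤ admissibleProb g α n a x δ := measureReal_nonneg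

lemma admissibleProb_le_one (hg : Regular g α) (n : ℕ) (a x : ℝ) {δ : ℝ} (hδ : 0 < δ) :
    admissibleProb g α n a x δ ≤ 1 := by
  have := hg.isProbabilityMeasure
  have h1 := (lintegral_mono (μ := Measure.pi fun _ : Fin (n - 1) => sampleLaw g α)
    (freeLength_le n a x δ)).trans_eq (show _ = ENNReal.ofReal δ by simp)
  rw [lintegral_freeLength_eq hg n a x hδ, ENNReal.ofReal_le_ofReal_iff hδ.le] at h1
  exact (mul_le_iff_le_one_right hδ).1 h1

/-- Same scheme with the levels inside the window. On the exceptional event the void set is at most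
the whole interval of levels, which gives the error term on the right. -/
lemma le_admissibleProb (hg : Regular g α) {n : ℕ} (hn : 2 ≤ n) {a : ℝ} (ha0 : 0 < a) (ha : a < 2)
    {x δ s t r κ σ ℓ p : ℝ} (hδ : 0 < δ) (hs : 0 ≤ s) (hst : s ≤ t)
    (ht : cdf g t < 1)
    (hr : r ≤ 1) (hκ0 : 0 < κ) (hκ : κ ≤ (1 - cdf g t) ^ 2 * r / 2)
    (hsx : x + r ≤ s) (htx : t + r ≤ x + δ)
    (hσ : σ = (1 - a / 2) / (1 - (cdf g s - κ - 1 / n))) (hℓ : a / ((n : ℝ) - 1) < ℓ * σ)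
    (htℓ : excessCdf g α t + ℓ ≤ 1)
    (hp : ∀ η ∈ Ioo (excessCdf g α s) (excessCdf g α t), (sampleLaw g α).real (Ico η (η + ℓ)) ≤ p)
    (hp1 : p ≤ 1) :
    σ * ((excessCdf g α t - excessCdf g α s) * (1 - p) ^ (n - 1)) / δ ≤
      admissibleProb g α n a x δ + 2 * (deviationBound α a n / κ) *
        (σ * (excessCdf g α t - excessCdf g α s) / δ) := by
  have := hg.isProbabilityMeasure
  set P := Measure.pi fun _ : Fin (n - 1) => sampleLaw g α with hP
  set bad : Set (Fin (n - 1) → ℝ) :=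
    {y | κ ≤ totalDeviation g α a n y s} ∪ {y | κ ≤ totalDeviation g α a n y t} with hbad
  have hB0 : 0 ≤ deviationBound α a n := by unfold deviationBound; positivity
  have hgt : cdf g s ≤ cdf g t := hg.mono_cdf hst
  have hinv : (0 : ℝ) < 1 / n := by positivity
  have hσ0 : 0 < σ := by rw [hσ]; apply div_pos <;> linarith
  have hH := hg.mono_excessCdf hst
  have hHs := sub_nonneg.2 hH
  have h1p : 0 ≤ 1 - p := by linarith
  have hcast : ((n - 1 : ℕ) : ℝ) = n - 1 := by rw [Nat.cast_sub (by omega)]; simp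
  have hn1 : (2 : ℝ) ≤ n := by exact_mod_cast hn
  have hPbad : P bad ≤ ENNReal.ofReal (2 * (deviationBound α a n / κ)) := by
    refine (measure_union_le _ _).trans ?_
    rw [two_mul, ENNReal.ofReal_add (by positivity) (by positivity)]
    exact add_le_add (measure_totalDeviation_ge hg hn a s hκ0)
      (measure_totalDeviation_ge hg hn a t hκ0)
  set C := ENNReal.ofReal (σ * (excessCdf g α t - excessCdf g α s)) with hC
  have hpt : ∀ᵐ y ∂P,
      ENNReal.ofReal σ * volume (voidSet y (excessCdf g α s) (excessCdf g α t) ℓ) ≤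
        freeLength n a x δ y + bad.indicator (fun _ => C) y := by
    filter_upwards [ae_mem_Icc hg (n - 1)] with y hy
    by_cases hyb : y ∈ bad
    · rw [indicator_of_mem hyb, hC, ENNReal.ofReal_mul hσ0.le, ← Real.volume_Ioo]
      refine le_add_left ?_
      gcongr
      exact fun η hη => hη.1
    · rw [indicator_of_notMem hyb, add_zero]
      simp only [hbad, mem_union, mem_ofPred_eq, not_or, not_le] at hyb
      obtain ⟨ht1, -⟩ := profile_close hg hn ha (hs.trans hst) (by linarith) le_rfl hr hκ hyb.2
      obtain ⟨hs1, hs2⟩ := profile_close hg hn ha hs (q := 1 - cdf g t) (by linarith) (by linarith)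
        hr hκ hyb.1
      refine le_volume_admissible hn ha0 ha hy (hg.excessCdf_nonneg hs) ?_ ?_ hσ0 ?_ hℓ htℓ
      · have := (abs_le.1 hs1).1
        linarith
      · have := (abs_le.1 ht1).2
        linarith
      · rw [slope_eq hn, hσ]
        have h2 := (abs_le.1 hs2).1
        have h4 : (count y (excessCdf g α s) : ℝ) ≤ n - 1 := by
          rw [← hcast]; exact_mod_cast count_le y _
        -- Deviations are normalised by `n - 1`, slopes by `n`; this accounts for the `1/n` in `σ`.
        have h3 : (count y (excessCdf g α s) : ℝ) / ((n - 1 : ℕ) : ℝ) -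
            count y (excessCdf g α s) / n ≤ 1 / n := by
          rw [hcast]
          have h5 : (count y (excessCdf g α s) : ℝ) / ((n : ℝ) - 1) -
              count y (excessCdf g α s) / n = count y (excessCdf g α s) / ((n : ℝ) - 1) * (1 / n) := by
            have : (n : ℝ) - 1 ≠ 0 := by linarith
            field_simp
            ring
          rw [h5]
          exact mul_le_of_le_one_left hinv.le (div_le_one_of_le₀ h4 (by linarith))
        have h6 : (count y (excessCdf g α s) : ℝ) / n < 1 := by
          rw [div_lt_one (by linarith)]; linarith
        apply div_le_div_of_nonneg_left <;> linarith
  have hvoid : ENNReal.ofReal ((excessCdf g α t - excessCdf g α s) * (1 - p) ^ (n - 1)) ≤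
      ∫⁻ y, volume (voidSet y (excessCdf g α s) (excessCdf g α t) ℓ) ∂P := by
    rw [hP, lintegral_voidSet]
    calc _ = ∫⁻ _ in Ioo (excessCdf g α s) (excessCdf g α t),
          ENNReal.ofReal ((1 - p) ^ (n - 1)) := by
          rw [setLIntegral_const, Real.volume_Ioo, mul_comm (ENNReal.ofReal _),
            ENNReal.ofReal_mul hHs]
      _ ≤ _ := by
          refine setLIntegral_mono' measurableSet_Ioo fun η hη => ENNReal.ofReal_le_ofReal ?_
          have h2 := hp η hη
          exact pow_le_pow_left₀ h1p (by linarith) _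
  have hpr := admissibleProb_nonneg g α n a x δ
  have hint : ENNReal.ofReal (σ * ((excessCdf g α t - excessCdf g α s) * (1 - p) ^ (n - 1))) ≤
      ENNReal.ofReal (δ * admissibleProb g α n a x δ + σ * (excessCdf g α t - excessCdf g α s) *
        (2 * (deviationBound α a n / κ))) := by
    calc _ ≤ ENNReal.ofReal σ *
          ∫⁻ y, volume (voidSet y (excessCdf g α s) (excessCdf g α t) ℓ) ∂P := by
          rw [ENNReal.ofReal_mul hσ0.le]
          gcongr
      _ = ∫⁻ y, ENNReal.ofReal σ *
          volume (voidSet y (excessCdf g α s) (excessCdf g α t) ℓ) ∂P :=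
          (lintegral_const_mul _ (measurable_volume_voidSet _ _ _)).symm
      _ ≤ ∫⁻ y, freeLength n a x δ y + bad.indicator (fun _ => C) y ∂P := lintegral_mono_ae hpt
      _ = ∫⁻ y, freeLength n a x δ y ∂P + ∫⁻ y, bad.indicator (fun _ => C) y ∂P :=
          lintegral_add_left (measurable_freeLength n a x δ) _
      _ ≤ ENNReal.ofReal (δ * admissibleProb g α n a x δ) +
          C * ENNReal.ofReal (2 * (deviationBound α a n / κ)) := by
          rw [lintegral_freeLength_eq hg n a x hδ]
          refine add_le_add le_rfl ((lintegral_indicator_const_le _ _).trans ?_)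
          gcongr
      _ = _ := by
          rw [hC, ← ENNReal.ofReal_mul (by positivity), ← ENNReal.ofReal_add (by positivity)
            (by positivity)]
  rw [ENNReal.ofReal_le_ofReal_iff (by positivity)] at hint
  rw [div_le_iff₀ hδ]
  refine hint.trans_eq ?_
  field_simp

/-- For use where `G` reaches 1. On the good event at most `1 + (n - 1)(1 - G(s) + κ)` particles can
matter, each blocking two radii. -/
lemma le_admissibleProb_tail (hg : Regular g α) {n : ℕ} (hn : 2 ≤ n) {a : ℝ} (ha0 : 0 < a)
    (ha : a < 2) {x δ s r κ : ℝ} (hδ : 0 < δ) (hs : 0 ≤ s) (hG : cdf g s < 1)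
    (hr : r ≤ 1) (hκ0 : 0 < κ) (hκ : κ ≤ (1 - cdf g s) ^ 2 * r / 2) (hsx : s + r ≤ x) :
    1 - deviationBound α a n / κ -
      (1 + ((n : ℝ) - 1) * (1 - cdf g s + κ)) * (2 * (a / ((n : ℝ) - 1))) / δ ≤
      admissibleProb g α n a x δ := by
  have := hg.isProbabilityMeasure
  set P := Measure.pi fun _ : Fin (n - 1) => sampleLaw g α with hP
  set bad : Set (Fin (n - 1) → ℝ) := {y | κ ≤ totalDeviation g α a n y s} with hbad
  have hB0 : 0 ≤ deviationBound α a n := by unfold deviationBound; positivity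
  have hcast : ((n - 1 : ℕ) : ℝ) = n - 1 := by rw [Nat.cast_sub (by omega)]; simp
  have hn1 : (2 : ℝ) ≤ n := by exact_mod_cast hn
  have hε := radius_pos hn ha0
  set K := (1 + ((n : ℝ) - 1) * (1 - cdf g s + κ)) * (2 * (a / ((n : ℝ) - 1))) with hK
  have hK0 : 0 ≤ K := by
    rw [hK]
    have : 0 ≤ ((n : ℝ) - 1) * (1 - cdf g s + κ) := mul_nonneg (by linarith) (by linarith)
    positivity
  have hPbad : P bad ≤ ENNReal.ofReal (deviationBound α a n / κ) :=
    measure_totalDeviation_ge hg hn a s hκ0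
  have hpt : ∀ᵐ y ∂P, ENNReal.ofReal δ ≤ freeLength n a x δ y +
      (bad.indicator (fun _ => ENNReal.ofReal δ) y + ENNReal.ofReal K) := by
    filter_upwards [ae_mem_Icc hg (n - 1)] with y hy
    by_cases hyb : y ∈ bad
    · rw [indicator_of_mem hyb]
      exact le_add_left le_self_add
    · rw [indicator_of_notMem hyb, zero_add]
      simp only [hbad, mem_ofPred_eq, not_le] at hyb
      obtain ⟨hs1, hs2⟩ := profile_close hg hn ha hs (by linarith) le_rfl hr hκ hyb
      have h1 := volume_not_admissible_le (δ := δ) hn ha0 ha hy (hg.excessCdf_le_one s)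
        (x := x) (by have := (abs_le.1 hs1).2; linarith)
      calc ENNReal.ofReal δ = volume (Icc x (x + δ)) := by simp
        _ ≤ volume (({u | Admissible n a (simplexMap n a (spacings n y)) u} ∩ Icc x (x + δ)) ∪
            (Icc x (x + δ) \ {u | Admissible n a (simplexMap n a (spacings n y)) u})) := by
            refine measure_mono fun u hu => ?_
            by_cases h : u ∈ {u | Admissible n a (simplexMap n a (spacings n y)) u}
            · exact Or.inl ⟨h, hu⟩
            · exact Or.inr ⟨hu, h⟩
        _ ≤ _ := measure_union_le _ _
        _ ≤ _ := by
            refine add_le_add le_rfl (h1.trans (ENNReal.ofReal_le_ofReal ?_))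
            rw [hK]
            have h2 := (abs_le.1 hs2).1
            have h3 : (cdf g s - κ) * ((n : ℝ) - 1) ≤ count y (excessCdf g α s) := by
              rw [hcast, ← sub_nonneg, sub_neg_eq_add] at h2
              rw [← le_div_iff₀ (by linarith)]
              linarith
            gcongr
            linarith
  have hpr := admissibleProb_nonneg g α n a x δ
  have hint : ENNReal.ofReal δ ≤ ENNReal.ofReal (δ * admissibleProb g α n a x δ +
      (δ * (deviationBound α a n / κ) + K)) := by
    calc ENNReal.ofReal δ = ∫⁻ _, ENNReal.ofReal δ ∂P := by simp
      _ ≤ ∫⁻ y, freeLength n a x δ y +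
          (bad.indicator (fun _ => ENNReal.ofReal δ) y + ENNReal.ofReal K) ∂P :=
          lintegral_mono_ae hpt
      _ = ∫⁻ y, freeLength n a x δ y ∂P +
          (∫⁻ y, bad.indicator (fun _ => ENNReal.ofReal δ) y ∂P + ENNReal.ofReal K) := by
          rw [lintegral_add_left (measurable_freeLength n a x δ),
            lintegral_add_right _ measurable_const]
          simp
      _ ≤ ENNReal.ofReal (δ * admissibleProb g α n a x δ) +
          (ENNReal.ofReal δ * ENNReal.ofReal (deviationBound α a n / κ) + ENNReal.ofReal K) := by
          rw [lintegral_freeLength_eq hg n a x hδ]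
          refine add_le_add le_rfl (add_le_add ((lintegral_indicator_const_le _ _).trans ?_) le_rfl)
          gcongr
      _ = _ := by
          rw [← ENNReal.ofReal_mul hδ.le, ← ENNReal.ofReal_add (by positivity) hK0,
            ← ENNReal.ofReal_add (by positivity) (by positivity)]
  rw [ENNReal.ofReal_le_ofReal_iff (by positivity)] at hint
  have h1 : δ * (1 - deviationBound α a n / κ - K / δ) ≤ δ * admissibleProb g α n a x δ := by
    have : δ * (1 - deviationBound α a n / κ - K / δ) =
        δ - δ * (deviationBound α a n / κ) - K := by
      field_simp
    linarith
  exact le_of_mul_le_mul_left h1 hδ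

end FiniteBounds

/-! ### Passage to the limit -/

section Limits

variable {g : ℝ → ℝ} {α : ℝ}

lemma exists_excessCdf_shift (hg : Regular g α) {s t B η ℓ : ℝ} (hst : s ≤ t)
    (htB : t ≤ B) (hℓ : 0 ≤ ℓ) (hB : excessCdf g α t + ℓ ≤ excessCdf g α B)
    (hη : η ∈ Ioo (excessCdf g α s) (excessCdf g α t)) :
    ∃ u v, s ≤ u ∧ u ≤ v ∧ v ≤ B ∧ excessCdf g α u = η ∧ excessCdf g α v = η + ℓ := by
  obtain ⟨u, hu, rfl⟩ := intermediate_value_Icc hst hg.cont_excessCdf.continuousOn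
    (Ioo_subset_Icc_self hη)
  obtain ⟨v, hv, hv'⟩ := intermediate_value_Icc (hu.2.trans htB) hg.cont_excessCdf.continuousOn
    (show excessCdf g α u + ℓ ∈ Icc _ _ from ⟨by linarith, by linarith [hg.mono_excessCdf hu.2]⟩)
  exact ⟨u, v, hu.1, hv.1, hv.2, rfl, hv'⟩

/-- Every interval of levels is `[H(u), H(v))`, with mass `∫ g` and length `∫ h` over `[u, v]`.
Comparing `g` with `c h` replaces continuity of `ψ = g/h` and avoids dividing by `h`, which may
vanish. -/
lemma mul_le_sampleLaw_Ico (hg : Regular g α) {s t B ℓ c : ℝ} (hs : 0 ≤ s) (hst : s ≤ t)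
    (htB : t ≤ B) (hℓ : 0 ≤ ℓ) (hB : excessCdf g α t + ℓ ≤ excessCdf g α B)
    (hc : ∀ u ∈ Icc s B, c * excessDensity g α u ≤ g u) :
    ∀ η ∈ Ioo (excessCdf g α s) (excessCdf g α t),
      c * ℓ ≤ (sampleLaw g α).real (Ico η (η + ℓ)) := by
  intro η hη
  obtain ⟨u, v, hu, huv, hv, rfl, hv'⟩ := exists_excessCdf_shift hg hst htB hℓ hB hη
  have h1 : ℓ = ∫ w in u..v, excessDensity g α w := by
    rw [← cdf_sub hg.cont_excess]
    linarith
  rw [← hv', hg.sampleLaw_Ico (hs.trans hu) huv, cdf_sub hg.cont, h1,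
    ← intervalIntegral.integral_const_mul]
  exact intervalIntegral.integral_mono_on huv ((hg.cont_excess.const_mul c).intervalIntegrable _ _)
    (hg.cont.intervalIntegrable _ _) fun w hw => hc w ⟨hu.trans hw.1, hw.2.trans hv⟩

lemma sampleLaw_Ico_le_mul (hg : Regular g α) {s t B ℓ c : ℝ} (hs : 0 ≤ s) (hst : s ≤ t)
    (htB : t ≤ B) (hℓ : 0 ≤ ℓ) (hB : excessCdf g α t + ℓ ≤ excessCdf g α B)
    (hc : ∀ u ∈ Icc s B, g u ≤ c * excessDensity g α u) :
    ∀ η ∈ Ioo (excessCdf g α s) (excessCdf g α t),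
      (sampleLaw g α).real (Ico η (η + ℓ)) ≤ c * ℓ := by
  intro η hη
  obtain ⟨u, v, hu, huv, hv, rfl, hv'⟩ := exists_excessCdf_shift hg hst htB hℓ hB hη
  have h1 : ℓ = ∫ w in u..v, excessDensity g α w := by
    rw [← cdf_sub hg.cont_excess]
    linarith
  rw [← hv', hg.sampleLaw_Ico (hs.trans hu) huv, cdf_sub hg.cont, h1,
    ← intervalIntegral.integral_const_mul]
  exact intervalIntegral.integral_mono_on huv (hg.cont.intervalIntegrable _ _)
    ((hg.cont_excess.const_mul c).intervalIntegrable _ _)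
    fun w hw => hc w ⟨hu.trans hw.1, hw.2.trans hv⟩

/-- Both end points move with `n`, hence strict differentiability of `H`. -/
lemma tendsto_excessCdf_slope (hg : Regular g α) {x : ℝ} {s t δ : ℕ → ℝ}
    (hs : Tendsto s atTop (𝓝 x)) (ht : Tendsto t atTop (𝓝 x))
    (hδ : ∀ n, δ n ≠ 0) (hst : Tendsto (fun n => (t n - s n) / δ n) atTop (𝓝 1)) :
    Tendsto (fun n => (excessCdf g α (t n) - excessCdf g α (s n)) / δ n) atTop
      (𝓝 (excessDensity g α x)) := by
  have hd : HasStrictDerivAt (excessCdf g α) (excessDensity g α x) x :=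
    intervalIntegral.integral_hasStrictDerivAt_right (hg.cont_excess.intervalIntegrable _ _)
      (hg.cont_excess.stronglyMeasurableAtFilter _ _) hg.cont_excess.continuousAt
  have hlit := hd.isLittleO.comp_tendsto (ht.prodMk_nhds hs)
  have h1 : (fun n => t n - s n) =O[atTop] δ :=
    Asymptotics.isBigO_of_div_tendsto_nhds (Eventually.of_forall fun n h => absurd h (hδ n)) 1 hst
  have h2 := (hlit.trans_isBigO h1).tendsto_div_nhds_zero
  have h3 := h2.add (hst.mul_const (excessDensity g α x))
  simp only [zero_add, one_mul] at h3
  refine h3.congr fun n => ?_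
  simp only [Function.comp, ContinuousLinearMap.toSpanSingleton_apply, smul_eq_mul]
  have := hδ n
  field_simp
  ring

lemma tendsto_one_sub_pow_pred {ℓ : ℕ → ℝ} {c L : ℝ}
    (hℓ : Tendsto (fun n : ℕ => ((n : ℝ) - 1) * ℓ n) atTop (𝓝 L)) :
    Tendsto (fun n : ℕ => (1 - c * ℓ n) ^ (n - 1)) atTop (𝓝 (Real.exp (-(c * L)))) := by
  have h1 : Tendsto (fun k : ℕ => (k : ℝ) * (-(c * ℓ (k + 1)))) atTop (𝓝 (-(c * L))) := by
    have := ((hℓ.comp (tendsto_add_atTop_nat 1)).const_mul c).neg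
    refine this.congr fun k => ?_
    simp only [Function.comp]
    push_cast
    ring
  have h2 := (Real.tendsto_one_add_pow_exp_of_tendsto h1).comp (tendsto_sub_atTop_nat 1)
  refine h2.congr' ?_
  filter_upwards [eventually_ge_atTop 1] with n hn
  simp only [Function.comp, Nat.sub_add_cancel hn]
  rw [← sub_eq_add_neg]

/-- Window lengths `δ` that decay slowly with respect to the fluctuations of the configuration. -/
structure Scaling (α : ℝ) (a δ : ℕ → ℝ) : Prop where
  tendsto_a : Tendsto a atTop (𝓝 α)
  a_pos : ∀ n, 2 ≤ n → 0 < a n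
  a_lt : ∀ n, 2 ≤ n → a n < 2
  pos : ∀ n, 0 < δ n
  tendsto_zero : Tendsto δ atTop (𝓝 0)
  deviation : Tendsto (fun n => deviationBound α (a n) n / δ n ^ 5) atTop (𝓝 0)
  radius : Tendsto (fun n : ℕ => 1 / ((n : ℝ) - 1) / δ n) atTop (𝓝 0)

variable {a δ : ℕ → ℝ}

lemma Scaling.tendsto_pow (hS : Scaling α a δ) {k : ℕ} (hk : k ≠ 0) :
    Tendsto (fun n => δ n ^ k) atTop (𝓝 0) := by
  simpa [hk] using hS.tendsto_zero.pow k

lemma Scaling.eventually_pow_le (hS : Scaling α a δ) {u : ℕ → ℝ} {L : ℝ}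
    (hu : Tendsto u atTop (𝓝 L)) (hL : 0 < L) {k l : ℕ} (hkl : k < l) :
    ∀ᶠ n in atTop, δ n ^ l ≤ u n * δ n ^ k := by
  filter_upwards [(hS.tendsto_pow (k := l - k) (by omega)).eventually_lt hu hL] with n hn
  have h1 : δ n ^ l = δ n ^ (l - k) * δ n ^ k := by rw [← pow_add, Nat.sub_add_cancel hkl.le]
  rw [h1]
  exact mul_le_mul_of_nonneg_right hn.le (pow_pos (hS.pos n) _).le

lemma tendsto_natCast_sub_one : Tendsto (fun n : ℕ => (n : ℝ) - 1) atTop atTop :=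
  tendsto_atTop_add_const_right _ _ tendsto_natCast_atTop_atTop

lemma Scaling.tendsto_radius (hS : Scaling α a δ) {σ : ℕ → ℝ} {σ₀ : ℝ}
    (hσ : Tendsto σ atTop (𝓝 σ₀)) (hσ₀ : σ₀ ≠ 0) :
    Tendsto (fun n => a n / ((n : ℝ) - 1) / σ n) atTop (𝓝 0) := by
  have := (hS.tendsto_a.div_atTop tendsto_natCast_sub_one).div hσ hσ₀
  rwa [zero_div] at this

lemma Scaling.tendsto_mul_radius (hS : Scaling α a δ) {σ : ℕ → ℝ} {σ₀ : ℝ}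
    (hσ : Tendsto σ atTop (𝓝 σ₀)) (hσ₀ : σ₀ ≠ 0) :
    Tendsto (fun n : ℕ => ((n : ℝ) - 1) * (a n / ((n : ℝ) - 1) / σ n)) atTop (𝓝 (α / σ₀)) := by
  refine (hS.tendsto_a.div hσ hσ₀).congr' ?_
  filter_upwards [eventually_ge_atTop 2] with n hn
  have : (2 : ℝ) ≤ n := by exact_mod_cast hn
  have : (n : ℝ) - 1 ≠ 0 := by linarith
  simp only [Pi.div_apply]
  field_simp

/-- Limit of the slope of the profile at the position `x`. -/
def limitSlope (g : ℝ → ℝ) (α x : ℝ) : ℝ := (1 - α / 2) / (1 - cdf g x)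

lemma limitSlope_mul (hg : Regular g α) {x : ℝ} (hx : cdf g x < 1) :
    limitSlope g α x * excessDensity g α x = 1 - α * g x := by
  have : 1 - cdf g x ≠ 0 := by linarith
  rw [limitSlope, div_mul_eq_mul_div, hg.excess_mul]
  field_simp

lemma limitSlope_pos (hg : Regular g α) {x : ℝ} (hx : cdf g x < 1) : 0 < limitSlope g α x :=
  div_pos hg.half_pos (by linarith)

lemma eventually_admissibleProb_lt (hg : Regular g α) (hS : Scaling α a δ) {x : ℝ} (hx : 0 ≤ x)
    (hGx : cdf g x < 1) {c : ℝ} (hc : ∀ᶠ u in 𝓝 x, c * excessDensity g α u ≤ g u)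
    {L : ℝ} (hL : (1 - α * g x) * Real.exp (-(c * (α / limitSlope g α x))) < L) :
    ∀ᶠ n in atTop, admissibleProb g α n (a n) x (δ n) < L := by
  have hδ0 := hS.tendsto_zero
  -- The window is enlarged by the tolerance `δ^2`, negligible with respect to `δ`, and truncated at
  -- the origin.
  set s : ℕ → ℝ := fun n => max (x - δ n ^ 2) 0 with hs_def
  set t : ℕ → ℝ := fun n => x + δ n + δ n ^ 2 with ht_def
  have hs : Tendsto s atTop (𝓝 x) := by
    have h1 : Tendsto (fun n => x - δ n ^ 2) atTop (𝓝 x) := by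
      simpa using (hS.tendsto_pow two_ne_zero).const_sub x
    simpa [hx] using h1.max (tendsto_const_nhds (x := (0 : ℝ)))
  have ht : Tendsto t atTop (𝓝 x) := by
    simpa using (hδ0.const_add x).add (hS.tendsto_pow two_ne_zero)
  have hsx : ∀ n, s n ≤ x := fun n => max_le (by linarith [sq_nonneg (δ n)]) hx
  have hsx' : ∀ n, x - δ n ^ 2 ≤ s n := fun n => le_max_left _ _
  have hxt : ∀ n, x ≤ t n := fun n => by
    have := hS.pos n
    have := sq_nonneg (δ n)
    simp only [ht_def]
    linarith
  have hslope : Tendsto (fun n => (t n - s n) / δ n) atTop (𝓝 1) := by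
    have h1 : Tendsto (fun n => 1 + 2 * δ n) atTop (𝓝 1) := by
      simpa using (hδ0.const_mul 2).const_add 1
    refine tendsto_of_tendsto_of_tendsto_of_le_of_le tendsto_const_nhds h1 (fun n => ?_) fun n => ?_
    · have := hS.pos n
      rw [le_div_iff₀ this]
      have := sq_nonneg (δ n)
      have := hsx n
      simp only [ht_def]
      linarith
    · have := hS.pos n
      rw [div_le_iff₀ this]
      have := hsx' n
      simp only [ht_def]
      nlinarith
  have hH := tendsto_excessCdf_slope hg hs ht (fun n => (hS.pos n).ne') hslope
  have hGt : Tendsto (fun n => cdf g (t n)) atTop (𝓝 (cdf g x)) :=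
    hg.cont_cdf.continuousAt.tendsto.comp ht
  have hGt5 : Tendsto (fun n => cdf g (t n) + δ n ^ 5) atTop (𝓝 (cdf g x)) := by
    simpa using hGt.add (hS.tendsto_pow (k := 5) (by norm_num))
  set σ : ℕ → ℝ := fun n => (1 - a n / 2) / (1 - (cdf g (t n) + δ n ^ 5)) with hσ_def
  have hσ₀ := limitSlope_pos hg hGx
  have hσ : Tendsto σ atTop (𝓝 (limitSlope g α x)) :=
    ((hS.tendsto_a.div_const 2).const_sub 1).div (hGt5.const_sub 1) (by linarith)
  set ℓ : ℕ → ℝ := fun n => a n / ((n : ℝ) - 1) / σ n with hℓ_def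
  have hℓ0 : Tendsto ℓ atTop (𝓝 0) := hS.tendsto_radius hσ hσ₀.ne'
  have hpow := tendsto_one_sub_pow_pred (c := c) (hS.tendsto_mul_radius hσ hσ₀.ne')
  have hlim : Tendsto (fun n => 2 * (deviationBound α (a n) n / δ n ^ 5) +
      σ n * ((excessCdf g α (t n) - excessCdf g α (s n)) * (1 - c * ℓ n) ^ (n - 1)) / δ n) atTop
      (𝓝 ((1 - α * g x) * Real.exp (-(c * (α / limitSlope g α x))))) := by
    have h1 := (hS.deviation.const_mul 2).add ((hσ.mul hH).mul hpow)
    rw [limitSlope_mul hg hGx, mul_zero, zero_add] at h1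
    refine h1.congr fun n => ?_
    ring
  obtain ⟨d, hd, hcd⟩ := Metric.eventually_nhds_iff_ball.1 hc
  have hHB : excessCdf g α x < excessCdf g α (x + d / 2) := hg.excessCdf_lt hx (by linarith) hGx
  have hHt : Tendsto (fun n => excessCdf g α (t n) + ℓ n) atTop (𝓝 (excessCdf g α x)) := by
    simpa using (hg.cont_excessCdf.continuousAt.tendsto.comp ht).add hℓ0
  have hu : Tendsto (fun n => (1 - cdf g (t n)) ^ 2 / 2) atTop (𝓝 ((1 - cdf g x) ^ 2 / 2)) :=
    ((hGt.const_sub 1).pow 2).div_const 2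
  have hu0 : 0 < (1 - cdf g x) ^ 2 / 2 := by
    have : 0 < 1 - cdf g x := by linarith
    positivity
  have hcℓ : Tendsto (fun n => c * ℓ n) atTop (𝓝 0) := by simpa using hℓ0.const_mul c
  filter_upwards [eventually_ge_atTop 2, hlim.eventually_lt_const hL,
    hHt.eventually_lt_const hHB, hGt5.eventually_lt_const hGx,
    hS.eventually_pow_le hu hu0 (show 2 < 5 by norm_num),
    hσ.eventually_const_lt hσ₀, hcℓ.eventually_lt_const one_pos,
    hs.eventually_const_lt (show x - d < x by linarith),
    ht.eventually_lt_const (show x < x + d / 2 by linarith),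
    (hS.tendsto_pow two_ne_zero).eventually_lt_const one_pos] with n hn h1 h2 h3 h4 h5 h6 h7 h8 h9
  have ha0 := hS.a_pos n hn
  have hst : s n ≤ t n := (hsx n).trans (hxt n)
  have hs0 : 0 ≤ s n := le_max_right _ _
  have hℓn : 0 ≤ ℓ n := div_nonneg (radius_pos hn ha0).le h5.le
  refine (admissibleProb_le hg hn ha0 (hS.a_lt n hn) hx (hS.pos n) hs0 hst h3
    (r := δ n ^ 2) (σ := σ n) (ℓ := ℓ n) h9.le (pow_pos (hS.pos n) 5)
    (h4.trans_eq (by ring)) ?_ le_rfl rfl ?_ ?_ h6.le).trans_lt h1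
  · rcases le_total (x - δ n ^ 2) 0 with h | h
    · left; exact max_eq_right h
    · right; simp only [hs_def, max_eq_left h]; linarith
  · exact (div_mul_cancel₀ _ h5.ne').le
  · refine mul_le_sampleLaw_Ico hg hs0 hst h8.le hℓn h2.le fun u hu => hcd u ?_
    rw [Metric.mem_ball, Real.dist_eq, abs_lt]
    constructor <;> linarith [hu.1, hu.2]

lemma eventually_lt_admissibleProb (hg : Regular g α) (hS : Scaling α a δ) {x : ℝ} (hx : 0 ≤ x)
    (hGx : cdf g x < 1) {c : ℝ} (hc : ∀ᶠ u in 𝓝 x, g u ≤ c * excessDensity g α u)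
    {L : ℝ} (hL : L < (1 - α * g x) * Real.exp (-(c * (α / limitSlope g α x)))) :
    ∀ᶠ n in atTop, L < admissibleProb g α n (a n) x (δ n) := by
  have hδ0 := hS.tendsto_zero
  set s : ℕ → ℝ := fun n => x + δ n ^ 2 with hs_def
  set t : ℕ → ℝ := fun n => x + δ n - δ n ^ 2 with ht_def
  have hs : Tendsto s atTop (𝓝 x) := by
    simpa using (hS.tendsto_pow two_ne_zero).const_add x
  have ht : Tendsto t atTop (𝓝 x) := by
    simpa using (hδ0.const_add x).sub (hS.tendsto_pow two_ne_zero)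
  have hslope : Tendsto (fun n => (t n - s n) / δ n) atTop (𝓝 1) := by
    have h1 : Tendsto (fun n => 1 - 2 * δ n) atTop (𝓝 1) := by
      simpa using (hδ0.const_mul 2).const_sub 1
    refine h1.congr fun n => ?_
    have := (hS.pos n).ne'
    simp only [hs_def, ht_def]
    field_simp
    ring
  have hH := tendsto_excessCdf_slope hg hs ht (fun n => (hS.pos n).ne') hslope
  have hGt : Tendsto (fun n => cdf g (t n)) atTop (𝓝 (cdf g x)) :=
    hg.cont_cdf.continuousAt.tendsto.comp ht
  have hGs5 : Tendsto (fun n : ℕ => cdf g (s n) - δ n ^ 5 - 1 / (n : ℝ)) atTop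
      (𝓝 (cdf g x)) := by
    simpa using ((hg.cont_cdf.continuousAt.tendsto.comp hs).sub
      (hS.tendsto_pow (k := 5) (by norm_num))).sub tendsto_one_div_atTop_nhds_zero_nat
  set σ : ℕ → ℝ := fun n => (1 - a n / 2) / (1 - (cdf g (s n) - δ n ^ 5 - 1 / (n : ℝ))) with hσ_def
  have hσ₀ := limitSlope_pos hg hGx
  have hσ : Tendsto σ atTop (𝓝 (limitSlope g α x)) :=
    ((hS.tendsto_a.div_const 2).const_sub 1).div (hGs5.const_sub 1) (by linarith)
  -- The factor `1 + δ` makes `ℓσ` strictly larger than the radius without changing the limit of `(n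
  -- - 1)ℓ`.
  set ℓ : ℕ → ℝ := fun n => (1 + δ n) * (a n / ((n : ℝ) - 1) / σ n) with hℓ_def
  have h1δ : Tendsto (fun n => 1 + δ n) atTop (𝓝 1) := by simpa using hδ0.const_add 1
  have hℓ0 : Tendsto ℓ atTop (𝓝 0) := by
    simpa using h1δ.mul (hS.tendsto_radius hσ hσ₀.ne')
  have hnℓ : Tendsto (fun n : ℕ => ((n : ℝ) - 1) * ℓ n) atTop (𝓝 (α / limitSlope g α x)) := by
    have := h1δ.mul (hS.tendsto_mul_radius hσ hσ₀.ne')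
    rw [one_mul] at this
    refine this.congr fun n => ?_
    simp only [hℓ_def]
    ring
  have hpow := tendsto_one_sub_pow_pred (c := c) hnℓ
  have hlim : Tendsto (fun n =>
      σ n * ((excessCdf g α (t n) - excessCdf g α (s n)) * (1 - c * ℓ n) ^ (n - 1)) / δ n -
      2 * (deviationBound α (a n) n / δ n ^ 5) *
        (σ n * (excessCdf g α (t n) - excessCdf g α (s n)) / δ n)) atTop
      (𝓝 ((1 - α * g x) * Real.exp (-(c * (α / limitSlope g α x))))) := by
    have h1 := ((hσ.mul hH).mul hpow).sub ((hS.deviation.const_mul 2).mul (hσ.mul hH))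
    rw [limitSlope_mul hg hGx, mul_zero, zero_mul, sub_zero] at h1
    refine h1.congr fun n => ?_
    ring
  obtain ⟨d, hd, hcd⟩ := Metric.eventually_nhds_iff_ball.1 hc
  have hHB : excessCdf g α x < excessCdf g α (x + d / 2) := hg.excessCdf_lt hx (by linarith) hGx
  have hHt : Tendsto (fun n => excessCdf g α (t n) + ℓ n) atTop (𝓝 (excessCdf g α x)) := by
    simpa using (hg.cont_excessCdf.continuousAt.tendsto.comp ht).add hℓ0
  have hu : Tendsto (fun n => (1 - cdf g (t n)) ^ 2 / 2) atTop (𝓝 ((1 - cdf g x) ^ 2 / 2)) :=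
    ((hGt.const_sub 1).pow 2).div_const 2
  have hu0 : 0 < (1 - cdf g x) ^ 2 / 2 := by
    have : 0 < 1 - cdf g x := by linarith
    positivity
  have hcℓ : Tendsto (fun n => c * ℓ n) atTop (𝓝 0) := by simpa using hℓ0.const_mul c
  filter_upwards [eventually_ge_atTop 2, hlim.eventually_const_lt hL,
    hHt.eventually_lt_const hHB, hGt.eventually_lt_const hGx,
    hS.eventually_pow_le hu hu0 (show 2 < 5 by norm_num),
    hσ.eventually_const_lt hσ₀, hcℓ.eventually_lt_const one_pos,
    ht.eventually_lt_const (show x < x + d / 2 by linarith),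
    hδ0.eventually_lt_const (show (0 : ℝ) < 1 / 2 by norm_num)] with n hn h1 h2 h3 h4 h5 h6 h8 h9
  have ha0 := hS.a_pos n hn
  have hδn := hS.pos n
  have hsq : 2 * δ n ^ 2 ≤ δ n := by nlinarith
  have hxs : x ≤ s n := by
    simp only [hs_def]; linarith [sq_nonneg (δ n)]
  have hst : s n ≤ t n := by
    simp only [hs_def, ht_def]; linarith
  have hs0 : 0 ≤ s n := hx.trans hxs
  have hbase : 0 < a n / ((n : ℝ) - 1) / σ n := div_pos (radius_pos hn ha0) h5
  have hℓn : 0 ≤ ℓ n := mul_nonneg (by linarith) hbase.le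
  have := le_admissibleProb hg hn ha0 (hS.a_lt n hn) (x := x) hδn hs0 hst h3
    (r := δ n ^ 2) (σ := σ n) (ℓ := ℓ n) (p := c * ℓ n) (by nlinarith) (pow_pos hδn 5)
    (h4.trans_eq (by ring)) le_rfl (by simp only [ht_def]; linarith) rfl ?_
    (h2.le.trans (hg.excessCdf_le_one _)) ?_ h6.le
  · linarith
  · have h10 : ℓ n * σ n = (1 + δ n) * (a n / ((n : ℝ) - 1)) := by
      simp only [hℓ_def]
      rw [mul_assoc, div_mul_cancel₀ _ h5.ne']
    rw [h10]
    exact lt_mul_of_one_lt_left (radius_pos hn ha0) (by linarith)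
  · refine sampleLaw_Ico_le_mul hg hs0 hst h8.le hℓn h2.le fun u hu => hcd u ?_
    rw [Metric.mem_ball, Real.dist_eq, abs_lt]
    constructor <;> linarith [hu.1, hu.2]

/-- If `αg(x) < 1`, then `g/h` is continuous at `x`, so any `c` on either side of `g(x)/h(x)` is
allowed near `x`; let `c` tend to that value. -/
lemma tendsto_admissibleProb_of_cdf_lt (hg : Regular g α) (hS : Scaling α a δ) {x : ℝ}
    (hx : 0 ≤ x) (hGx : cdf g x < 1) :
    Tendsto (fun n => admissibleProb g α n (a n) x (δ n)) atTop
      (𝓝 ((1 - α * g x) * Real.exp (-(α * g x / (1 - α * g x))))) := by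
  rcases (hg.mul_le x).lt_or_eq with hlt | heq
  · have hpos := hg.excess_pos hlt hGx
    have hq : 0 < 1 - cdf g x := by linarith
    have hα := hg.half_pos
    have hval : g x / excessDensity g α x * (α / limitSlope g α x) = α * g x / (1 - α * g x) := by
      rw [← limitSlope_mul hg hGx]
      have := (limitSlope_pos hg hGx).ne'
      field_simp
    have hcont : Tendsto (fun c => (1 - α * g x) * Real.exp (-(c * (α / limitSlope g α x))))
        (𝓝 (g x / excessDensity g α x))
        (𝓝 ((1 - α * g x) * Real.exp (-(α * g x / (1 - α * g x))))) := by
      rw [← hval]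
      have : Continuous fun c => (1 - α * g x) * Real.exp (-(c * (α / limitSlope g α x))) := by
        fun_prop
      exact this.continuousAt.tendsto
    rw [tendsto_order]
    constructor
    · intro L hL
      have h1 := (hcont.eventually_const_lt hL).filter_mono
        (nhdsWithin_le_nhds (s := Ioi (g x / excessDensity g α x)))
      obtain ⟨c, hcL, hc⟩ := (h1.and self_mem_nhdsWithin).exists
      refine eventually_lt_admissibleProb hg hS hx hGx ?_ hcL
      have h2 : g x < c * excessDensity g α x := (div_lt_iff₀ hpos).1 hc
      filter_upwards [hg.cont.continuousAt.tendsto.eventually_lt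
        (hg.cont_excess.continuousAt.tendsto.const_mul c) h2] with u hu using hu.le
    · intro L hL
      -- When `g(x) = 0` the choice `c = 0` is already sharp.
      rcases (hg.nonneg x).eq_or_lt with h0 | h0
      · refine eventually_admissibleProb_lt hg hS hx hGx (c := 0)
          (Eventually.of_forall fun u => by simpa using hg.nonneg u) ?_
        rw [← h0] at hL ⊢
        simpa using hL
      · have h1 := (hcont.eventually_lt_const hL).filter_mono
          (nhdsWithin_le_nhds (s := Iio (g x / excessDensity g α x)))
        have h3 : Ioo 0 (g x / excessDensity g α x) ∈ 𝓝[<] (g x / excessDensity g α x) :=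
          Ioo_mem_nhdsLT (div_pos h0 hpos)
        obtain ⟨c, hcL, hc⟩ := (h1.and h3).exists
        refine eventually_admissibleProb_lt hg hS hx hGx ?_ hcL
        have h2 : c * excessDensity g α x < g x := (lt_div_iff₀ hpos).1 hc.2
        filter_upwards [(hg.cont_excess.continuousAt.tendsto.const_mul c).eventually_lt
          hg.cont.continuousAt.tendsto h2] with u hu using hu.le
  -- Case `αg(x) = 1`: the prefactor is 0 whatever value the quotient by 0 takes, and the upper
  -- bound with `c = 0` suffices.
  · rw [heq, sub_self, zero_mul, tendsto_order]
    refine ⟨fun L hL => Eventually.of_forall fun n =>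
      hL.trans_le (admissibleProb_nonneg _ _ _ _ _ _), fun L hL => ?_⟩
    refine eventually_admissibleProb_lt hg hS hx hGx (c := 0)
      (Eventually.of_forall fun u => by simpa using hg.nonneg u) ?_
    simpa [heq] using hL

/-- `G` attains its maximum at `x`. -/
lemma density_eq_zero_of_cdf_eq_one (hg : Regular g α) {x : ℝ} (hGx : cdf g x = 1) : g x = 0 := by
  refine IsLocalMax.hasDerivAt_eq_zero (f := cdf g) (Eventually.of_forall fun u => ?_)
    (hasDerivAt_cdf hg.cont x)
  rw [hGx]
  exact hg.cdf_le_one u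

/-- Choose `s` slightly left of `x` with `1 - G(s)` of order `δ`. About `nκδ` particles lie beyond
`s` and block a proportion of about `2ακ` of the window, with `κ` arbitrarily small. -/
lemma tendsto_admissibleProb_of_cdf_eq (hg : Regular g α) (hS : Scaling α a δ) {x : ℝ}
    (hx : 0 ≤ x) (hGx : cdf g x = 1) :
    Tendsto (fun n => admissibleProb g α n (a n) x (δ n)) atTop (𝓝 1) := by
  rw [tendsto_order]
  refine ⟨fun L hL => ?_, fun L hL => Eventually.of_forall fun n =>
    (admissibleProb_le_one hg n _ x (hS.pos n)).trans_lt hL⟩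
  have hα := hg.pos
  -- Chosen so that the blocked proportion `2ακ` equals `(1 - L)/2`.
  set κ := (1 - L) / (4 * α) with hκ_def
  have hκ : 0 < κ := div_pos (by linarith) (by positivity)
  have hlim : Tendsto (fun n : ℕ => 1 - deviationBound α (a n) n / δ n ^ 5 -
      2 * a n * (1 / ((n : ℝ) - 1) / δ n + (κ + δ n ^ 4))) atTop
      (𝓝 (1 - 0 - 2 * α * (0 + (κ + 0)))) :=
    (hS.deviation.const_sub 1).sub ((hS.tendsto_a.const_mul 2).mul
      (hS.radius.add ((hS.tendsto_pow (k := 4) (by norm_num)).const_add κ)))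
  have hL' : L < 1 - 0 - 2 * α * (0 + (κ + 0)) := by
    have : 2 * α * (0 + (κ + 0)) = (1 - L) / 2 := by
      rw [hκ_def]
      field_simp
      ring
    linarith
  have hκδ : Tendsto (fun n => κ * δ n) atTop (𝓝 0) := by simpa using hS.tendsto_zero.const_mul κ
  filter_upwards [eventually_ge_atTop 2, hlim.eventually_const_lt hL',
    hκδ.eventually_lt_const one_pos, hS.tendsto_zero.eventually_lt_const one_pos,
    hS.tendsto_zero.eventually_lt_const (show 0 < α * κ by positivity),
    hS.tendsto_zero.eventually_lt_const (show 0 < κ ^ 2 / 2 by positivity)]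
    with n hn h1 h2 h3 h4 h5
  have hδn := hS.pos n
  have hn1 : (2 : ℝ) ≤ n := by exact_mod_cast hn
  obtain ⟨s, hs, hGs⟩ := intermediate_value_Icc hx hg.cont_cdf.continuousOn
    (show 1 - κ * δ n ∈ Icc _ _ by
      rw [cdf_zero, hGx]
      exact ⟨by linarith, by linarith [mul_pos hκ hδn]⟩)
  -- Since `g ≤ 1/α`, a loss of mass `κδ` takes a distance at least `ακδ`, which exceeds `δ^2` once
  -- `δ < ακ`.
  have hsx : s + δ n ^ 2 ≤ x := by
    have h6 : κ * δ n ≤ (x - s) * (1 / α) := by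
      have h7 : κ * δ n = ∫ u in s..x, g u := by rw [← cdf_sub hg.cont, hGs, hGx]; ring
      have h8 : ∫ u in s..x, g u ≤ ∫ _ in s..x, 1 / α :=
        intervalIntegral.integral_mono_on hs.2 (hg.cont.intervalIntegrable _ _)
          intervalIntegrable_const fun u _ => by
            rw [le_div_iff₀ hα, mul_comm]; exact hg.mul_le u
      rw [h7]
      refine h8.trans_eq ?_
      rw [intervalIntegral.integral_const, smul_eq_mul]
    rw [mul_one_div, le_div_iff₀ hα] at h6
    nlinarith
  have h6 : δ n ^ 5 ≤ (1 - cdf g s) ^ 2 * δ n ^ 2 / 2 := by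
    rw [hGs]
    have : δ n * δ n ^ 4 ≤ κ ^ 2 / 2 * δ n ^ 4 := by gcongr
    nlinarith
  have := le_admissibleProb_tail hg hn (hS.a_pos n hn) (hS.a_lt n hn) hδn hs.1
    (by rw [hGs]; linarith [mul_pos hκ hδn]) (r := δ n ^ 2) (by nlinarith) (pow_pos hδn 5) h6 hsx
  refine h1.trans_le (le_trans (le_of_eq ?_) this)
  rw [hGs]
  have : (n : ℝ) - 1 ≠ 0 := by linarith
  field_simp
  ring

lemma tendsto_admissibleProb (hg : Regular g α) (hS : Scaling α a δ) {x : ℝ} (hx : 0 ≤ x) :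
    Tendsto (fun n => admissibleProb g α n (a n) x (δ n)) atTop
      (𝓝 ((1 - α * g x) * Real.exp (-(α * g x / (1 - α * g x))))) := by
  rcases (hg.cdf_le_one x).lt_or_eq with h | h
  · exact tendsto_admissibleProb_of_cdf_lt hg hS hx h
  · simpa [density_eq_zero_of_cdf_eq_one hg h] using tendsto_admissibleProb_of_cdf_eq hg hS hx h

end Limits

/-! ### Continuous extension of the density to the whole line -/

section Extension

variable {f f' g : ℝ → ℝ} {α : ℝ}

lemma cdf_congr (h : ∀ x, 0 ≤ x → f x = f' x) {x : ℝ} (hx : 0 ≤ x) : cdf f x = cdf f' x :=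
  intervalIntegral.integral_congr fun t ht => h t (by rw [uIcc_of_le hx] at ht; exact ht.1)

lemma excessDensity_congr (h : ∀ x, 0 ≤ x → f x = f' x) {x : ℝ} (hx : 0 ≤ x) :
    excessDensity f α x = excessDensity f' α x := by
  rw [excessDensity, excessDensity, h x hx, cdf_congr h hx]

lemma quantile_congr (h : ∀ x, 0 ≤ x → f x = f' x) (η : ℝ) : quantile f η = quantile f' η := by
  rw [quantile, quantile]
  congr 1
  ext x
  exact and_congr_right fun hx => by rw [cdf_congr h hx]

lemma quantile_nonneg (f : ℝ → ℝ) (η : ℝ) : 0 ≤ quantile f η :=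
  Real.sInf_nonneg fun _ hx => hx.1

lemma sampleLaw_congr (h : ∀ x, 0 ≤ x → f x = f' x) : sampleLaw f α = sampleLaw f' α := by
  have h1 : ∀ η, sampleDensity f α η = sampleDensity f' α η := fun η => by
    rw [sampleDensity, sampleDensity,
      quantile_congr (fun x hx => excessDensity_congr (α := α) h hx) η,
      h _ (quantile_nonneg _ _), excessDensity_congr h (quantile_nonneg _ _)]
  simp only [sampleLaw, h1]

lemma admissibleProb_congr (h : ∀ x, 0 ≤ x → f x = f' x) (n : ℕ) (a x δ : ℝ) :
    admissibleProb f α n a x δ = admissibleProb f' α n a x δ := by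
  rw [admissibleProb, admissibleProb, configLaw, configLaw, sampleLaw_congr h]

/-- The extension is constant on the negative axis. Were `αg > 1` somewhere, it would be so on an
open set meeting the positive axis, against the almost everywhere bound; hence `αg ≤ 1` everywhere.
-/
lemma regular_extension (hα0 : 0 < α) (hα2 : α < 2) (hg_cont : ContinuousOn g (Ici 0))
    (hg_nonneg : ∀ x, 0 ≤ x → 0 ≤ g x) (hg_mass : ∫ x in Ioi (0 : ℝ), g x = 1)
    (hg_mean : ∫ x in Ioi (0 : ℝ), x * g x = 1)
    (hg_lt : ∀ᵐ x ∂(volume.restrict (Ioi (0 : ℝ))), g x < 1 / α) :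
    Regular (fun x => g (max x 0)) α := by
  have heq : ∀ x ∈ Ioi (0 : ℝ), g (max x 0) = g x := fun x hx => by
    rw [max_eq_left (le_of_lt hx)]
  have hcont : Continuous fun x => g (max x 0) :=
    hg_cont.comp_continuous (by fun_prop) fun x => le_max_right x 0
  have hlt : ∀ᵐ x ∂(volume.restrict (Ioi (0 : ℝ))), α * g (max x 0) < 1 := by
    filter_upwards [hg_lt, ae_restrict_mem measurableSet_Ioi] with x h1 h2
    rw [heq x h2, mul_comm]
    exact (lt_div_iff₀ hα0).1 h1
  refine ⟨hα0, hα2, hcont, fun x => hg_nonneg _ (le_max_right x 0), fun x => ?_, hlt, ?_, ?_⟩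
  · by_contra! hcon
    set U := {u | 1 < α * g (max u 0)} with hU
    have hUo : IsOpen U := isOpen_lt continuous_const (hcont.const_mul α)
    have hx0 : max x 0 ∈ U := by
      rw [hU, mem_ofPred_eq, max_eq_left (le_max_right x 0)]
      exact hcon
    have hne : (U ∩ Ioi 0).Nonempty := by
      have h1 : U ∈ 𝓝[>] (max x 0) := nhdsWithin_le_nhds (hUo.mem_nhds hx0)
      have h2 : Ioi (max x 0) ∈ 𝓝[>] (max x 0) := self_mem_nhdsWithin
      obtain ⟨u, hu1, hu2⟩ := Filter.nonempty_of_mem (inter_mem h1 h2)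
      exact ⟨u, hu1, (le_max_right x 0).trans_lt hu2⟩
    have hpos := (hUo.inter isOpen_Ioi).measure_pos volume hne
    rw [ae_restrict_iff' measurableSet_Ioi] at hlt
    refine hpos.ne' (measure_mono_null (fun u hu => ?_) hlt)
    simp only [mem_compl_iff, mem_ofPred_eq]
    intro h
    exact absurd (h hu.2) (not_lt.2 (le_of_lt hu.1))
  · rw [setIntegral_congr_fun measurableSet_Ioi heq, hg_mass]
  · have heq' : ∀ x ∈ Ioi (0 : ℝ), x * g (max x 0) = x * g x := fun x hx => by rw [heq x hx]
    rw [setIntegral_congr_fun measurableSet_Ioi heq', hg_mean]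

end Extension

/-! ### Choice of the window lengths -/

lemma exists_scaling {α : ℝ} {a : ℕ → ℝ} (ha : Tendsto a atTop (𝓝 α))
    (h0 : ∀ n, 2 ≤ n → 0 < a n) (h2 : ∀ n, 2 ≤ n → a n < 2) : ∃ δ, Scaling α a δ := by
  -- `ρ` is positive for every `n` and of the order of the fluctuations. With `δ = ρ^(1/8)` the
  -- deviation bound is at most `7δ^8` and `1/(n - 1)` at most `4δ^16`, so after division by `δ^5`
  -- and `δ` both vanish in the limit.
  set ρ : ℕ → ℝ := fun n => 1 / √((n : ℝ) + 1) + |a n - α| with hρ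
  have hρ0 : ∀ n, 0 < ρ n := fun n => by simp only [hρ]; positivity
  have hρlim : Tendsto ρ atTop (𝓝 0) := by
    have h1 : Tendsto (fun n : ℕ => 1 / √((n : ℝ) + 1)) atTop (𝓝 0) := by
      refine tendsto_const_nhds.div_atTop (Real.tendsto_sqrt_atTop.comp ?_)
      exact tendsto_atTop_add_const_right _ _ tendsto_natCast_atTop_atTop
    have h3 : Tendsto (fun n => |a n - α|) atTop (𝓝 0) := by
      simpa using (ha.sub_const α).abs
    have h4 := h1.add h3
    rwa [add_zero] at h4
  have hpow : ∀ n, (ρ n ^ (1 / 8 : ℝ)) ^ 8 = ρ n := fun n => by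
    rw [← Real.rpow_natCast, ← Real.rpow_mul (hρ0 n).le]
    norm_num
  have hpos : ∀ n, 0 < ρ n ^ (1 / 8 : ℝ) := fun n => Real.rpow_pos_of_pos (hρ0 n) _
  have hlim : Tendsto (fun n => ρ n ^ (1 / 8 : ℝ)) atTop (𝓝 0) := by
    have := hρlim.rpow_const (p := 1 / 8) (Or.inr (by norm_num))
    simpa using this
  have hsq : ∀ n, 2 ≤ n → 1 / √((n - 1 : ℕ) : ℝ) ≤ 2 * ρ n ∧ 1 / ((n : ℝ) - 1) ≤ 4 * ρ n ^ 2 := by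
    intro n hn
    have hcast : ((n - 1 : ℕ) : ℝ) = n - 1 := by rw [Nat.cast_sub (by omega)]; simp
    have hn1 : (2 : ℝ) ≤ n := by exact_mod_cast hn
    have h3 : √((n : ℝ) + 1) ≤ 2 * √((n : ℝ) - 1) := by
      rw [← Real.sqrt_sq (show (0 : ℝ) ≤ 2 by norm_num), ← Real.sqrt_mul (by norm_num)]
      exact Real.sqrt_le_sqrt (by linarith)
    have h4 : 0 < √((n : ℝ) - 1) := Real.sqrt_pos.2 (by linarith)
    have h5 : 0 < √((n : ℝ) + 1) := Real.sqrt_pos.2 (by linarith)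
    have h6 : 1 / √((n : ℝ) - 1) ≤ 2 * (1 / √((n : ℝ) + 1)) := by
      rw [mul_one_div, div_le_div_iff₀ h4 h5]
      linarith
    have h7 : 1 / √((n : ℝ) + 1) ≤ ρ n := le_add_of_nonneg_right (abs_nonneg _)
    have h8 : 1 / √((n : ℝ) - 1) ≤ 2 * ρ n := by linarith
    rw [hcast]
    refine ⟨h8, ?_⟩
    have h9 : 1 / ((n : ℝ) - 1) = (1 / √((n : ℝ) - 1)) ^ 2 := by
      rw [div_pow, one_pow, Real.sq_sqrt (by linarith)]
    rw [h9]
    calc _ ≤ (2 * ρ n) ^ 2 := by gcongr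
      _ = _ := by ring
  refine ⟨fun n => ρ n ^ (1 / 8 : ℝ), ha, h0, h2, hpos, hlim, ?_, ?_⟩
  · have hl : Tendsto (fun n => (7 : ℝ) * (ρ n ^ (1 / 8 : ℝ)) ^ 3) atTop (𝓝 0) := by
      simpa using (hlim.pow 3).const_mul 7
    refine squeeze_zero' (Eventually.of_forall fun n => ?_) ?_ hl
    · have := hpos n
      unfold deviationBound
      positivity
    · filter_upwards [eventually_ge_atTop 2] with n hn
      obtain ⟨h3, -⟩ := hsq n hn
      have hp := hpos n
      have hn1 : (2 : ℝ) ≤ n := by exact_mod_cast hn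
      have hcast : ((n - 1 : ℕ) : ℝ) = n - 1 := by rw [Nat.cast_sub (by omega)]; simp
      have h4 : 1 / (n : ℝ) ≤ 1 / √((n - 1 : ℕ) : ℝ) := by
        rw [hcast]
        refine one_div_le_one_div_of_le (Real.sqrt_pos.2 (by linarith)) ?_
        rw [Real.sqrt_le_left (by linarith)]
        nlinarith
      have h5 : |a n - α| ≤ ρ n := le_add_of_nonneg_left (by positivity)
      rw [div_le_iff₀ (by positivity), mul_assoc, ← pow_add, hpow, deviationBound]
      have h6 : 2 / √((n - 1 : ℕ) : ℝ) = 2 * (1 / √((n - 1 : ℕ) : ℝ)) := by ring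
      linarith
  · have hl : Tendsto (fun n => (4 : ℝ) * (ρ n ^ (1 / 8 : ℝ)) ^ 15) atTop (𝓝 0) := by
      simpa using (hlim.pow 15).const_mul 4
    refine squeeze_zero' ?_ ?_ hl
    · filter_upwards [eventually_ge_atTop 2] with n hn
      have hn1 : (2 : ℝ) ≤ n := by exact_mod_cast hn
      exact div_nonneg (div_nonneg zero_le_one (by linarith)) (hpos n).le
    · filter_upwards [eventually_ge_atTop 2] with n hn
      rw [div_le_iff₀ (hpos n), mul_assoc, ← pow_succ,
        show (ρ n ^ (1 / 8 : ℝ)) ^ (15 + 1) = ((ρ n ^ (1 / 8 : ℝ)) ^ 8) ^ 2 by ring, hpow]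
      exact (hsq n hn).2

lemma alphaParam_pos {ε : ℝ} (hε : 0 < ε) {E : ℕ → ℝ} {n : ℕ} (hn : 2 ≤ n)
    (hE : ε * n * (n - 1) / 2 < E n) : 0 < alphaParam ε E n ∧ alphaParam ε E n < 2 := by
  have hn1 : (2 : ℝ) ≤ n := by exact_mod_cast hn
  have h1 : 0 < ε * n * ((n : ℝ) - 1) := mul_pos (by positivity) (by linarith)
  have h2 : 0 < E n := by linarith
  rw [alphaParam]
  exact ⟨div_pos h1 h2, by rw [div_lt_iff₀ h2]; linarith⟩

end KacExclusion

end

theorem proposition4p1 (α : ℝ) (hα0 : 0 < α) (hα2 : α < 2)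
    (g : ℝ → ℝ) (hg_cont : ContinuousOn g (Ici 0)) (hg_nonneg : ∀ x, 0 ≤ x → 0 ≤ g x)
    (hg_mass : ∫ x in Ioi (0 : ℝ), g x = 1) (hg_mean : ∫ x in Ioi (0 : ℝ), x * g x = 1)
    (hg_lt : ∀ᵐ x ∂(volume.restrict (Ioi (0 : ℝ))), g x < 1 / α)
    (ε : ℝ) (hε : 0 < ε) (E : ℕ → ℝ)
    (hE : ∀ n : ℕ, 2 ≤ n → ε * n * (n - 1) / 2 < E n)
    (hlim : Tendsto (KacExclusion.alphaParam ε E) atTop (𝓝 α)) :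
    ∃ δ : ℕ → ℝ, (∀ n, 0 < δ n) ∧ Tendsto δ atTop (𝓝 0) ∧
      ∀ x : ℝ, 0 ≤ x →
        Tendsto
          (fun n => KacExclusion.admissibleProb g α n (KacExclusion.alphaParam ε E n) x (δ n))
          atTop (𝓝 ((1 - α * g x) * Real.exp (-(α * g x / (1 - α * g x))))) := by
  obtain ⟨δ, hδ⟩ := KacExclusion.exists_scaling hlim
    (fun n hn => (KacExclusion.alphaParam_pos hε hn (hE n hn)).1)
    (fun n hn => (KacExclusion.alphaParam_pos hε hn (hE n hn)).2)
  have hg := KacExclusion.regular_extension hα0 hα2 hg_cont hg_nonneg hg_mass hg_mean hg_lt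
  refine ⟨δ, hδ.pos, hδ.tendsto_zero, fun x hx => ?_⟩
  have h := KacExclusion.tendsto_admissibleProb hg hδ hx
  simp only [max_eq_left hx] at h
  refine h.congr fun n => KacExclusion.admissibleProb_congr (fun u hu => ?_) n _ x (δ n)
  rw [max_eq_left hu]
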